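/- Let $M_0=\{(r,s)\in[0,1]^2 : r\in\{0,1\}\text{ or }s\in\{0,1\}\}$ be the boundary of the unit square. A square metric space is a metric space $X$ with all distances at most $2$, together with an injective map $S_X:M_0\to X$ such that $d_X(S_X(i,r),S_X(i,s))=|s-r|=d_X(S_X(r,i),S_X(s,i))$ for $i\in\{0,1\}$, $r,s\in[0,1]$, and $d_X(S_X(r,s),S_X(t,u))\ge|r-t|+|s-u|$ for $(r,s),(t,u)\in M_0$. Let $\mathsf{SquaMS}$ be the category of square metric spaces, whose morphisms $f:X\to Y$ are the maps with $d_Y(f(x),f(y))\le d_X(x,y)$ and $f\circ S_X=S_Y$. Let $N=\{0,1,2\}^2$. For a square metric space $X$ let $N\otimes X$ be the quotient of $N\times X$ by the equivalence relation $\sim$ generated by $((i,j),S_X(1,r))\sim((i+1,j),S_X(0,r))$ for $i\in\{0,1\}$, $j\in\{0,1,2\}$ and $((i,j),S_X(r,1))\sim((i,j+1),S_X(r,0))$ for $i\in\{0,1,2\}$, $j\in\{0,1\}$, where $r\in[0,1]$; write $n\otimes x$ for the class of $(n,x)$. It carries the quotient metric: the distance of $m\otimes x$ and $n\otimes y$ is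 the infimum, over all finite paths in $N\times X$ from $(m,x)$ to $(n,y)$, of the sum of the contributions of consecutive points, where two points related by $\sim$ contribute $0$, two other points $(k,z),(k,z')$ in the same copy contribute $\frac13 d_X(z,z')$, and two other points in different copies contribute $2$. Its boundary map is $S_{N\otimes X}(r,s)=(i,j)\otimes S_X(3r-i,3s-j)$ for any $(i,j)\in N$ with $3r-i,\,3s-j\in[0,1]$. With $(N\otimes f)(n\otimes x)=n\otimes f(x)$ this is an endofunctor $N\otimes-$ of $\mathsf{SquaMS}$. Let $C$ be the Cauchy completion functor on $\mathsf{SquaMS}$, with $S_{C(X)}$ the composite of $S_X$ with the canonical embedding $X\to C(X)$, and let $i_X:N\otimes C(X)\to C(N\otimes X)$ be the morphism that takes $n\otimes\lim_k x_k$ to $\lim_k (n\otimes x_k)$. Let $U_0=[0,1]^2$ with the taxicab metric $d((x,y),(x',y'))=|x-x'|+|y-y'|$ and the inclusion $M_0\to U_0$ as boundary map. **Theorem.** The functor $N\otimes-$ on $\mathsf{SquaMS}$ has an initial algebra. Let $(W,\lambda:N\otimes W\to W)$ be any initial algebra of $N\otimes-$, let $V=C(W)$ be the Cauchy completion of $W$,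 and let $\theta=C(\lambda)\circ i_W:N\otimes V\to V$. Then $\theta$ is an isomorphism, and $(V,\theta^{-1}:V\to N\otimes V)$ is a final coalgebra of $N\otimes-$: for every coalgebra $(B,\beta:B\to N\otimes B)$ there is a unique morphism $h:B\to V$ in $\mathsf{SquaMS}$ with $\theta^{-1}\circ h=(N\otimes h)\circ\beta$. Moreover, $V$ is isomorphic in $\mathsf{SquaMS}$ to $U_0$ with the taxicab metric. -/

import Mathlib

open CategoryTheory CategoryTheory.Limits

universe u

namespace SquareMetric

/-! ### The boundary of the unit square and square metric spaces -/

/-- The boundary of the unit square `[0,1]²`. -/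
def boundary : Set (ℝ × ℝ) :=
  {p | (p.1 = 0 ∨ p.1 = 1) ∧ p.2 ∈ Set.Icc (0 : ℝ) 1} ∪
    {p | p.1 ∈ Set.Icc (0 : ℝ) 1 ∧ (p.2 = 0 ∨ p.2 = 1)}

/-- The boundary of the unit square, as a type. -/
abbrev M0 : Type := boundary

/-- A square metric space: a metric space bounded by `2` with an injective map `S` from the
boundary of the unit square, such that distances along each of the four sides are those of the
unit interval (`dist_vertical`, `dist_horizontal`), and all distances between boundary points
dominate the taxicab distance (`taxi_le_dist`). -/
structure SquaMS : Type (u + 1) where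
  carrier : Type u
  [metric : MetricSpace carrier]
  S : M0 → carrier
  S_injective : Function.Injective S
  dist_le_two : ∀ x y : carrier, dist x y ≤ 2
  dist_vertical : ∀ p q : M0, p.1.1 = q.1.1 → (p.1.1 = 0 ∨ p.1.1 = 1) →
    dist (S p) (S q) = |q.1.2 - p.1.2|
  dist_horizontal : ∀ p q : M0, p.1.2 = q.1.2 → (p.1.2 = 0 ∨ p.1.2 = 1) →
    dist (S p) (S q) = |q.1.1 - p.1.1|
  taxi_le_dist : ∀ p q : M0, |p.1.1 - q.1.1| + |p.1.2 - q.1.2| ≤ dist (S p) (S q)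

attribute [instance] SquaMS.metric

/-- Morphisms of square metric spaces: short maps that preserve the boundary maps. -/
@[ext]
structure SquaMS.Hom (X Y : SquaMS.{u}) : Type u where
  toFun : X.carrier → Y.carrier
  short : ∀ x y, dist (toFun x) (toFun y) ≤ dist x y
  map_S : ∀ p : M0, toFun (X.S p) = Y.S p

instance : Category.{u} SquaMS.{u} where
  Hom X Y := SquaMS.Hom X Y
  id X := ⟨fun x => x, fun _ _ => le_rfl, fun _ => rfl⟩
  comp f g := ⟨fun x => g.toFun (f.toFun x),
    fun x y => (g.short _ _).trans (f.short x y),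
    fun p => by rw [f.map_S, g.map_S]⟩

/-! ### The set `N ⊗ X` -/

/-- The nine positions `(column, row)` of the `3 × 3` grid. -/
abbrev N : Type := Fin 3 × Fin 3

/-- The generating identifications between boundary points of the nine cells: the right side of a
cell is glued to the left side of its right neighbour, and the top side of a cell is glued to the
bottom side of its upper neighbour. -/
inductive GridGlue : N × M0 → N × M0 → Prop
  | horizontal (i i' j : Fin 3) (h : i'.val = i.val + 1) (p q : M0)
      (hp : p.1.1 = 1) (hq : q.1.1 = 0) (hpq : p.1.2 = q.1.2) :
      GridGlue ((i, j), p) ((i', j), q)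
  | vertical (i j j' : Fin 3) (h : j'.val = j.val + 1) (p q : M0)
      (hp : p.1.2 = 1) (hq : q.1.2 = 0) (hpq : p.1.1 = q.1.1) :
      GridGlue ((i, j), p) ((i, j'), q)

variable (X Y Z : SquaMS.{u})

/-- The generating identifications on `N × X`. -/
def Glue (a b : N × X.carrier) : Prop :=
  ∃ p q : M0, GridGlue (a.1, p) (b.1, q) ∧ a.2 = X.S p ∧ b.2 = X.S q

/-- The equivalence relation on `N × X` generated by the identifications. -/
def glueSetoid : Setoid (N × X.carrier) := Relation.EqvGen.setoid (Glue X)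

/-- The underlying set of `N ⊗ X`. -/
def Tensor : Type u := Quotient (glueSetoid X)

variable {X Y Z} in
/-- The element `n ⊗ x`. -/
def tmk (n : N) (x : X.carrier) : Tensor X := Quotient.mk (glueSetoid X) (n, x)

/-! ### The quotient metric -/

/-- The distance on `N × X`: the distance of `X` scaled by `1/3` in each copy, and `2` between
different copies. -/
noncomputable def cellDist (a b : N × X.carrier) : ℝ :=
  if a.1 = b.1 then dist a.2 b.2 / 3 else 2

open scoped Classical in
/-- The contribution of two consecutive points to the score of a path: `0` if they are
identified, and their distance in `N × X` otherwise. -/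
noncomputable def step (a b : N × X.carrier) : ℝ :=
  if (glueSetoid X) a b then 0 else cellDist X a b

/-- `PathScore X a b s`: there is a finite path in `N × X` from `a` to `b` with score `s`. -/
inductive PathScore : N × X.carrier → N × X.carrier → ℝ → Prop
  | nil (a : N × X.carrier) : PathScore a a 0
  | cons {a b c : N × X.carrier} {s : ℝ} (h : PathScore b c s) : PathScore a c (step X a b + s)

/-- The infimum of the scores of the finite paths from `a` to `b`. -/
noncomputable def pathDist (a b : N × X.carrier) : ℝ := sInf {s | PathScore X a b s}

theorem cellDist_nonneg (a b : N × X.carrier) : 0 ≤ cellDist X a b := by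
  unfold cellDist; split_ifs <;> positivity

theorem cellDist_le_two (a b : N × X.carrier) : cellDist X a b ≤ 2 := by
  unfold cellDist
  split_ifs
  · have := X.dist_le_two a.2 b.2
    linarith
  · exact le_rfl

theorem cellDist_comm (a b : N × X.carrier) : cellDist X a b = cellDist X b a := by
  unfold cellDist; simp only [eq_comm, dist_comm]

theorem step_nonneg (a b : N × X.carrier) : 0 ≤ step X a b := by
  unfold step; split_ifs
  · exact le_rfl
  · exact cellDist_nonneg X a b

theorem step_le_cellDist (a b : N × X.carrier) : step X a b ≤ cellDist X a b := by
  unfold step; split_ifs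
  · exact cellDist_nonneg X a b
  · exact le_rfl

theorem step_comm (a b : N × X.carrier) : step X a b = step X b a := by
  have h : (glueSetoid X) a b ↔ (glueSetoid X) b a :=
    ⟨fun h => (glueSetoid X).symm h, fun h => (glueSetoid X).symm h⟩
  unfold step
  by_cases h' : (glueSetoid X) a b
  · rw [if_pos h', if_pos (h.1 h')]
  · rw [if_neg h', if_neg (fun h'' => h' (h.2 h'')), cellDist_comm]

theorem step_of_rel {a b : N × X.carrier} (h : (glueSetoid X) a b) : step X a b = 0 := by
  unfold step; simp [h]

variable {X}

theorem PathScore.nonneg {a b : N × X.carrier} {s : ℝ} (h : PathScore X a b s) : 0 ≤ s := by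
  induction h with
  | nil a => exact le_rfl
  | cons h ih => exact add_nonneg (step_nonneg X _ _) ih

theorem PathScore.single (a b : N × X.carrier) : PathScore X a b (step X a b) := by
  simpa using PathScore.cons (a := a) (PathScore.nil (X := X) b)

theorem PathScore.append {a b c : N × X.carrier} {s t : ℝ} (h : PathScore X a b s)
    (h' : PathScore X b c t) : PathScore X a c (s + t) := by
  induction h with
  | nil a => simpa using h'
  | cons h ih =>
    rw [add_assoc]
    exact PathScore.cons (ih h')

theorem PathScore.symm {a b : N × X.carrier} {s : ℝ} (h : PathScore X a b s) :
    PathScore X b a s := by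
  induction h with
  | nil a => exact PathScore.nil a
  | @cons a b c s h ih =>
    have := ih.append (PathScore.single b a)
    rwa [step_comm, add_comm] at this

theorem bddBelow_scores (a b : N × X.carrier) : BddBelow {s | PathScore X a b s} :=
  ⟨0, fun _ h => PathScore.nonneg h⟩

theorem scores_nonempty (a b : N × X.carrier) : {s | PathScore X a b s}.Nonempty :=
  ⟨_, PathScore.single a b⟩

theorem pathDist_nonneg (a b : N × X.carrier) : 0 ≤ pathDist X a b :=
  le_csInf (scores_nonempty a b) fun _ h => PathScore.nonneg h

theorem pathDist_le_step (a b : N × X.carrier) : pathDist X a b ≤ step X a b :=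
  csInf_le (bddBelow_scores a b) (PathScore.single a b)

theorem pathDist_le_two (a b : N × X.carrier) : pathDist X a b ≤ 2 :=
  (pathDist_le_step a b).trans ((step_le_cellDist X a b).trans (cellDist_le_two X a b))

theorem pathDist_of_rel {a b : N × X.carrier} (h : (glueSetoid X) a b) : pathDist X a b = 0 :=
  le_antisymm ((pathDist_le_step a b).trans (step_of_rel X h).le) (pathDist_nonneg a b)

theorem pathDist_comm (a b : N × X.carrier) : pathDist X a b = pathDist X b a := by
  unfold pathDist
  congr 1
  ext s
  exact ⟨PathScore.symm, PathScore.symm⟩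

theorem pathDist_triangle (a b c : N × X.carrier) :
    pathDist X a c ≤ pathDist X a b + pathDist X b c := by
  refine le_of_forall_pos_le_add fun ε hε => ?_
  obtain ⟨s, hs, hs'⟩ := exists_lt_of_csInf_lt (scores_nonempty a b)
    (lt_add_of_pos_right (pathDist X a b) (half_pos hε))
  obtain ⟨t, ht, ht'⟩ := exists_lt_of_csInf_lt (scores_nonempty b c)
    (lt_add_of_pos_right (pathDist X b c) (half_pos hε))
  have := csInf_le (bddBelow_scores a c) (PathScore.append hs ht)
  change pathDist X a c ≤ s + t at this
  linarith

theorem pathDist_congr {a a' b b' : N × X.carrier} (h : (glueSetoid X) a a')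
    (h' : (glueSetoid X) b b') : pathDist X a b = pathDist X a' b' := by
  apply le_antisymm
  · have h1 := pathDist_triangle a a' b
    have h2 := pathDist_triangle a' b' b
    rw [pathDist_of_rel h] at h1
    rw [pathDist_of_rel ((glueSetoid X).symm h')] at h2
    linarith
  · have h1 := pathDist_triangle a' a b'
    have h2 := pathDist_triangle a b b'
    rw [pathDist_of_rel ((glueSetoid X).symm h)] at h1
    rw [pathDist_of_rel h'] at h2
    linarith

/-- A map on `N × X` that respects the identifications takes equal values on identified points. -/
theorem eq_of_rel {β : Type*} {F : N × X.carrier → β} (hF : ∀ a b, Glue X a b → F a = F b)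
    {a b : N × X.carrier} (h : (glueSetoid X) a b) : F a = F b := by
  change Relation.EqvGen (Glue X) a b at h
  induction h with
  | rel a b h => exact hF a b h
  | refl a => rfl
  | symm a b _ ih => exact ih.symm
  | trans a b c _ _ ih ih' => exact ih.trans ih'

/-- A map on `N × X` that respects the identifications, is `1/3`-Lipschitz on each copy and has
an image of diameter at most `2` is short for the quotient distance. -/
theorem dist_le_pathDist {β : Type*} [PseudoMetricSpace β] {F : N × X.carrier → β}
    (hF : ∀ a b, Glue X a b → F a = F b)
    (hcell : ∀ n x y, dist (F (n, x)) (F (n, y)) ≤ dist x y / 3)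
    (hbdd : ∀ a b, dist (F a) (F b) ≤ 2) (a b : N × X.carrier) :
    dist (F a) (F b) ≤ pathDist X a b := by
  have hstep : ∀ a b, dist (F a) (F b) ≤ step X a b := by
    intro a b
    unfold step
    split_ifs with h
    · rw [eq_of_rel hF h, dist_self]
    · unfold cellDist
      split_ifs with h'
      · obtain ⟨n, x⟩ := a
        obtain ⟨m, y⟩ := b
        obtain rfl : n = m := h'
        exact hcell n x y
      · exact hbdd a b
  refine le_csInf (scores_nonempty a b) fun s hs => ?_
  change PathScore X a b s at hs
  induction hs with
  | nil a => simp
  | @cons a b c s h ih =>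
    exact (dist_triangle _ (F b) _).trans (add_le_add (hstep a b) ih)

/-! ### Boundary points of the cells are identified exactly when they have the same position -/

/-- Three times the position in the unit square of the boundary point `p` of the cell `n`. -/
def pos (n : N) (p : M0) : ℝ × ℝ := ((n.1.val : ℝ) + p.1.1, (n.2.val : ℝ) + p.1.2)

theorem M0.fst_mem (p : M0) : p.1.1 ∈ Set.Icc (0 : ℝ) 1 := by
  obtain ⟨p, (⟨h | h, h'⟩ | ⟨h, h'⟩)⟩ := p <;> simp_all

theorem M0.snd_mem (p : M0) : p.1.2 ∈ Set.Icc (0 : ℝ) 1 := by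
  obtain ⟨p, (⟨h, h'⟩ | ⟨h', h | h⟩)⟩ := p <;> simp_all

theorem coord_cases {i k : ℕ} {r t : ℝ} (hr : r ∈ Set.Icc (0 : ℝ) 1) (ht : t ∈ Set.Icc (0 : ℝ) 1)
    (h : (i : ℝ) + r = k + t) :
    (i = k ∧ r = t) ∨ (k = i + 1 ∧ r = 1 ∧ t = 0) ∨ (i = k + 1 ∧ t = 1 ∧ r = 0) := by
  rcases lt_trichotomy i k with hik | hik | hik
  · right; left
    have h1 : (i : ℝ) + 1 ≤ k := by exact_mod_cast hik
    have h2 : (k : ℝ) = i + 1 := by linarith [hr.2, ht.1]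
    exact ⟨by exact_mod_cast h2, by linarith [hr.2, ht.1], by linarith [hr.2, ht.1]⟩
  · left
    subst hik
    exact ⟨rfl, by linarith⟩
  · right; right
    have h1 : (k : ℝ) + 1 ≤ i := by exact_mod_cast hik
    have h2 : (i : ℝ) = k + 1 := by linarith [hr.1, ht.2]
    exact ⟨by exact_mod_cast h2, by linarith [hr.1, ht.2], by linarith [hr.1, ht.2]⟩

theorem tmk_eq_of_glue {n m : N} {p q : M0} (h : GridGlue (n, p) (m, q)) :
    tmk n (X.S p) = tmk m (X.S q) :=
  Quotient.sound (s := glueSetoid X) (Relation.EqvGen.rel _ _ ⟨p, q, h, rfl, rfl⟩)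

theorem tmk_eq_of_same_column {i j l : Fin 3} {p q : M0}
    (hx : p.1.1 = q.1.1) (hy : (j.val : ℝ) + p.1.2 = l.val + q.1.2) :
    tmk (i, j) (X.S p) = tmk (i, l) (X.S q) := by
  rcases coord_cases p.snd_mem q.snd_mem hy with ⟨h, h'⟩ | ⟨h, h1, h2⟩ | ⟨h, h1, h2⟩
  · obtain rfl : j = l := Fin.ext h
    obtain rfl : p = q := Subtype.ext (Prod.ext hx h')
    rfl
  · exact tmk_eq_of_glue (GridGlue.vertical i j l h p q h1 h2 hx)
  · exact (tmk_eq_of_glue (GridGlue.vertical i l j h q p h1 h2 hx.symm)).symm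

theorem tmk_eq_of_pos_eq {n m : N} {p q : M0} (h : pos n p = pos m q) :
    tmk n (X.S p) = tmk m (X.S q) := by
  obtain ⟨i, j⟩ := n
  obtain ⟨k, l⟩ := m
  have hx : (i.val : ℝ) + p.1.1 = k.val + q.1.1 := congrArg Prod.fst h
  have hy : (j.val : ℝ) + p.1.2 = l.val + q.1.2 := congrArg Prod.snd h
  rcases coord_cases p.fst_mem q.fst_mem hx with ⟨h, h'⟩ | ⟨h, h1, h2⟩ | ⟨h, h1, h2⟩
  · obtain rfl : i = k := Fin.ext h
    exact tmk_eq_of_same_column h' hy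
  · let p' : M0 := ⟨(0, p.1.2), Or.inl ⟨Or.inl rfl, p.snd_mem⟩⟩
    have e1 : tmk (i, j) (X.S p) = tmk (k, j) (X.S p') :=
      tmk_eq_of_glue (GridGlue.horizontal i k j h p p' h1 rfl rfl)
    rw [e1]
    exact tmk_eq_of_same_column h2.symm hy
  · let p' : M0 := ⟨(1, p.1.2), Or.inl ⟨Or.inr rfl, p.snd_mem⟩⟩
    have e1 : tmk (k, j) (X.S p') = tmk (i, j) (X.S p) :=
      tmk_eq_of_glue (GridGlue.horizontal k i j h p' p rfl h2 rfl)
    rw [← e1]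
    exact tmk_eq_of_same_column h1.symm hy

theorem pos_eq_of_glue {n m : N} {p q : M0} (h : GridGlue (n, p) (m, q)) : pos n p = pos m q := by
  cases h with
  | horizontal i i' j h _ _ hp hq hpq => simp [pos, h, hp, hq, hpq]
  | vertical i j j' h _ _ hp hq hpq => simp [pos, h, hp, hq, hpq]

/-! ### Short functions on `N ⊗ X`, and the resulting lower bounds of the quotient distance -/

/-- For signs `a`, `b`, the function `S (r, s) ↦ a * r + b * s` extends to a short function on
`X` with values in an interval of length `2`. -/
theorem exists_short (X : SquaMS.{u}) (a b : ℝ) (ha : |a| = 1) (hb : |b| = 1) :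
    ∃ g : X.carrier → ℝ, (∀ x y, dist (g x) (g y) ≤ dist x y) ∧
      (∀ p : M0, g (X.S p) = a * p.1.1 + b * p.1.2) ∧
      ∀ x, g x ∈ Set.Icc (min a 0 + min b 0) (max a 0 + max b 0) := by
  have hbd : ∀ p : M0, a * p.1.1 + b * p.1.2 ∈
      Set.Icc (min a 0 + min b 0) (max a 0 + max b 0) := by
    intro p
    have h1 := p.fst_mem
    have h2 := p.snd_mem
    rcases eq_or_eq_neg_of_abs_eq ha with rfl | rfl <;>
      rcases eq_or_eq_neg_of_abs_eq hb with rfl | rfl <;>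
      norm_num <;> constructor <;> linarith [h1.1, h1.2, h2.1, h2.2]
  have hle : min a 0 + min b 0 ≤ max a 0 + max b 0 :=
    add_le_add (min_le_of_right_le (le_max_right _ _)) (min_le_of_right_le (le_max_right _ _))
  let f : X.carrier → ℝ := fun x =>
    a * (Function.extend X.S (fun p => p.1.1) 0 x) + b * (Function.extend X.S (fun p => p.1.2) 0 x)
  have hf : ∀ p, f (X.S p) = a * p.1.1 + b * p.1.2 := by
    intro p
    simp [f, X.S_injective.extend_apply]
  have hLip : LipschitzOnWith 1 f (Set.range X.S) := by
    refine LipschitzOnWith.of_dist_le_mul ?_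
    rintro _ ⟨p, rfl⟩ _ ⟨q, rfl⟩
    rw [hf, hf, NNReal.coe_one, one_mul, Real.dist_eq]
    calc |a * p.1.1 + b * p.1.2 - (a * q.1.1 + b * q.1.2)|
        = |a * (p.1.1 - q.1.1) + b * (p.1.2 - q.1.2)| := by congr 1; ring
      _ ≤ |a * (p.1.1 - q.1.1)| + |b * (p.1.2 - q.1.2)| := abs_add_le _ _
      _ = |p.1.1 - q.1.1| + |p.1.2 - q.1.2| := by rw [abs_mul, abs_mul, ha, hb, one_mul, one_mul]
      _ ≤ _ := X.taxi_le_dist p q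
  obtain ⟨g, hg, hfg⟩ := hLip.extend_real
  refine ⟨fun x => (Set.projIcc _ _ hle (g x) : ℝ), fun x y => ?_, fun p => ?_, fun x => ?_⟩
  · have h1 := (LipschitzWith.projIcc hle).comp hg
    simpa [Subtype.dist_eq] using h1.dist_le_mul x y
  · have : g (X.S p) = a * p.1.1 + b * p.1.2 := by
      rw [← hfg ⟨p, rfl⟩, hf]
    simp only [this]
    rw [Set.projIcc_of_mem hle (hbd p)]
  · exact Subtype.mem _

theorem signed_le_pathDist (X : SquaMS.{u}) (a b : ℝ) (ha : |a| = 1) (hb : |b| = 1) (n m : N)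
    (p q : M0) :
    |a * ((pos n p).1 - (pos m q).1) + b * ((pos n p).2 - (pos m q).2)| / 3 ≤
      pathDist X (n, X.S p) (m, X.S q) := by
  obtain ⟨g, hg, hgS, hgb⟩ := exists_short X a b ha hb
  let F : N × X.carrier → ℝ := fun c => (a * c.1.1.val + b * c.1.2.val + g c.2) / 3
  have hFS : ∀ n p, F (n, X.S p) = (a * (pos n p).1 + b * (pos n p).2) / 3 := by
    intro n p
    simp only [F, hgS, pos]
    ring
  have hrange : ∀ c, F c ∈ Set.Icc (min a 0 + min b 0) (max a 0 + max b 0) := by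
    rintro ⟨⟨i, j⟩, x⟩
    have hi : (i.val : ℝ) ≤ 2 := by exact_mod_cast Nat.le_of_lt_succ i.2
    have hj : (j.val : ℝ) ≤ 2 := by exact_mod_cast Nat.le_of_lt_succ j.2
    have hi' : (0 : ℝ) ≤ i.val := Nat.cast_nonneg _
    have hj' : (0 : ℝ) ≤ j.val := Nat.cast_nonneg _
    have := hgb x
    simp only [F]
    rcases eq_or_eq_neg_of_abs_eq ha with rfl | rfl <;>
      rcases eq_or_eq_neg_of_abs_eq hb with rfl | rfl <;>
      norm_num at this ⊢ <;> constructor <;> linarith [this.1, this.2]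
  have key := dist_le_pathDist (X := X) (F := F) ?_ ?_ ?_ (n, X.S p) (m, X.S q)
  · rw [hFS, hFS, Real.dist_eq] at key
    refine le_trans (le_of_eq ?_) key
    rw [← abs_of_pos (show (0 : ℝ) < 3 by norm_num), ← abs_div,
      abs_of_pos (show (0 : ℝ) < 3 by norm_num)]
    congr 1
    ring
  · rintro ⟨n, _⟩ ⟨m, _⟩ ⟨p, q, h, rfl, rfl⟩
    rw [hFS, hFS, pos_eq_of_glue h]
  · intro n x y
    have := hg x y
    rw [Real.dist_eq] at this ⊢
    simp only [F]
    rw [← sub_div, abs_div, abs_of_pos (show (0 : ℝ) < 3 by norm_num), add_sub_add_left_eq_sub]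
    exact div_le_div_of_nonneg_right this (by norm_num)
  · intro c d
    refine (Real.dist_le_of_mem_Icc (hrange c) (hrange d)).trans ?_
    rcases eq_or_eq_neg_of_abs_eq ha with rfl | rfl <;>
      rcases eq_or_eq_neg_of_abs_eq hb with rfl | rfl <;> norm_num

theorem taxi_le_pathDist (n m : N) (p q : M0) :
    (|(pos n p).1 - (pos m q).1| + |(pos n p).2 - (pos m q).2|) / 3 ≤
      pathDist X (n, X.S p) (m, X.S q) := by
  have h1 : |(1 : ℝ)| = 1 := abs_one
  have h2 : |(-1 : ℝ)| = 1 := by simp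
  set s := (pos n p).1 - (pos m q).1 with hs
  set t := (pos n p).2 - (pos m q).2 with ht
  have e1 := (div_le_iff₀ (show (0 : ℝ) < 3 by norm_num)).1 (signed_le_pathDist X 1 1 h1 h1 n m p q)
  have e2 := (div_le_iff₀ (show (0 : ℝ) < 3 by norm_num)).1
    (signed_le_pathDist X 1 (-1) h1 h2 n m p q)
  rw [← hs, ← ht] at e1 e2
  rw [div_le_iff₀ (by norm_num : (0 : ℝ) < 3)]
  have e1' := abs_le.1 e1
  have e2' := abs_le.1 e2
  rcases abs_cases s with ⟨hs', _⟩ | ⟨hs', _⟩ <;> rcases abs_cases t with ⟨ht', _⟩ | ⟨ht', _⟩ <;>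
    rw [hs', ht'] <;> linarith [e1'.1, e1'.2, e2'.1, e2'.2]

/-- The boundary of a square metric space is closed. -/
theorem isClosed_range_S (X : SquaMS.{u}) : IsClosed (Set.range X.S) := by
  have key : ∀ e : unitInterval → M0,
      (∀ s t, dist (X.S (e s)) (X.S (e t)) = |(t : ℝ) - s|) →
      IsClosed (Set.range fun t => X.S (e t)) := by
    intro e he
    have : Isometry fun t => X.S (e t) := Isometry.of_dist_eq fun s t => by
      rw [he, Subtype.dist_eq, Real.dist_eq, abs_sub_comm]
    exact (isCompact_range this.continuous).isClosed
  let e1 : unitInterval → M0 := fun t => ⟨(0, t), Or.inl ⟨Or.inl rfl, t.2⟩⟩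
  let e2 : unitInterval → M0 := fun t => ⟨(1, t), Or.inl ⟨Or.inr rfl, t.2⟩⟩
  let e3 : unitInterval → M0 := fun t => ⟨(t, 0), Or.inr ⟨t.2, Or.inl rfl⟩⟩
  let e4 : unitInterval → M0 := fun t => ⟨(t, 1), Or.inr ⟨t.2, Or.inr rfl⟩⟩
  have k1 := key e1 fun s t => X.dist_vertical _ _ rfl (Or.inl rfl)
  have k2 := key e2 fun s t => X.dist_vertical _ _ rfl (Or.inr rfl)
  have k3 := key e3 fun s t => X.dist_horizontal _ _ rfl (Or.inl rfl)
  have k4 := key e4 fun s t => X.dist_horizontal _ _ rfl (Or.inr rfl)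
  convert (k1.union k2).union (k3.union k4) using 1
  apply Set.Subset.antisymm
  · rintro _ ⟨⟨⟨x, y⟩, (⟨h | h, h'⟩ | ⟨h, h' | h'⟩)⟩, rfl⟩
    · exact Or.inl (Or.inl ⟨⟨y, h'⟩, congrArg X.S (Subtype.ext (Prod.ext h.symm rfl))⟩)
    · exact Or.inl (Or.inr ⟨⟨y, h'⟩, congrArg X.S (Subtype.ext (Prod.ext h.symm rfl))⟩)
    · exact Or.inr (Or.inl ⟨⟨x, h⟩, congrArg X.S (Subtype.ext (Prod.ext rfl h'.symm))⟩)
    · exact Or.inr (Or.inr ⟨⟨x, h⟩, congrArg X.S (Subtype.ext (Prod.ext rfl h'.symm))⟩)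
  · rintro _ ((⟨t, rfl⟩ | ⟨t, rfl⟩) | (⟨t, rfl⟩ | ⟨t, rfl⟩)) <;> exact ⟨_, rfl⟩

/-- A point of a cell that is not on its boundary has positive distance to all other points. -/
theorem eq_of_pathDist_eq_zero_of_interior {n m : N} {x y : X.carrier}
    (hx : x ∉ Set.range X.S) (h : pathDist X (n, x) (m, y) = 0) :
    (n, x) = (m, y) := by
  have hne : (Set.range X.S).Nonempty := ⟨_, ⟨⟨(0, 0), Or.inl ⟨Or.inl rfl, by simp⟩⟩, rfl⟩⟩
  set δ := Metric.infDist x (Set.range X.S) with hδ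
  have hpos : 0 < δ := ((isClosed_range_S X).notMem_iff_infDist_pos hne).1 hx
  have hδ2 : δ ≤ 2 := by
    obtain ⟨z, hz⟩ := hne
    exact (Metric.infDist_le_dist_of_mem hz).trans (X.dist_le_two _ _)
  have hSδ : ∀ p, δ ≤ dist x (X.S p) := fun p => Metric.infDist_le_dist_of_mem ⟨p, rfl⟩
  let F : N × X.carrier → ℝ := fun c => if n = c.1 then min (dist x c.2) δ / 3 else δ / 3
  have hFS : ∀ k p, F (k, X.S p) = δ / 3 := by
    intro k p
    simp only [F]
    rw [min_eq_right (hSδ p), ite_self]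
  have hrange : ∀ c, F c ∈ Set.Icc (0 : ℝ) (δ / 3) := by
    intro c
    simp only [F]
    split_ifs
    · exact ⟨by positivity, div_le_div_of_nonneg_right (min_le_right _ _) (by norm_num)⟩
    · exact ⟨by positivity, le_rfl⟩
  have key := dist_le_pathDist (X := X) (F := F) ?_ ?_ ?_ (n, x) (m, y)
  · rw [h] at key
    have hF := dist_le_zero.1 key
    have h0 : F (n, x) = 0 := by simp [F, hpos.le]
    rw [h0] at hF
    by_cases hnm : n = m
    · subst hnm
      simp only [F, if_true] at hF
      have h3 : min (dist x y) δ = 0 := by linarith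
      rcases min_choice (dist x y) δ with h4 | h4
      · rw [h4] at h3
        rw [dist_eq_zero.1 h3]
      · rw [h4] at h3
        exact absurd h3 hpos.ne'
    · simp only [F, if_neg hnm] at hF
      linarith
  · rintro ⟨n, _⟩ ⟨m, _⟩ ⟨p, q, h, rfl, rfl⟩
    exact (hFS n p).trans (hFS m q).symm
  · intro k u v
    simp only [F]
    split_ifs
    · rw [Real.dist_eq, ← sub_div, abs_div, abs_of_pos (show (0 : ℝ) < 3 by norm_num)]
      refine div_le_div_of_nonneg_right ?_ (by norm_num)
      refine (abs_min_sub_min_le_max _ _ _ _).trans ?_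
      rw [sub_self, abs_zero]
      refine max_le ?_ dist_nonneg
      rw [dist_comm x u, dist_comm x v]
      exact abs_dist_sub_le u v x
    · rw [dist_self]
      positivity
  · intro c d
    refine (Real.dist_le_of_mem_Icc (hrange c) (hrange d)).trans ?_
    linarith

theorem tmk_eq_of_pathDist_eq_zero {n m : N} {x y : X.carrier}
    (h : pathDist X (n, x) (m, y) = 0) : tmk n x = tmk m y := by
  by_cases hx : x ∈ Set.range X.S
  · by_cases hy : y ∈ Set.range X.S
    · obtain ⟨p, rfl⟩ := hx
      obtain ⟨q, rfl⟩ := hy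
      have h1 := taxi_le_pathDist (X := X) n m p q
      rw [h] at h1
      have h2 := abs_nonneg ((pos n p).1 - (pos m q).1)
      have h3 := abs_nonneg ((pos n p).2 - (pos m q).2)
      apply tmk_eq_of_pos_eq
      ext
      · exact sub_eq_zero.1 (abs_eq_zero.1 (by linarith))
      · exact sub_eq_zero.1 (abs_eq_zero.1 (by linarith))
    · rw [pathDist_comm] at h
      exact congrArg (Quotient.mk (glueSetoid X)) (eq_of_pathDist_eq_zero_of_interior hy h).symm
  · exact congrArg (Quotient.mk (glueSetoid X)) (eq_of_pathDist_eq_zero_of_interior hx h)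

/-- The quotient metric on `N ⊗ X`. -/
noncomputable instance : MetricSpace (Tensor X) where
  dist := Quotient.lift₂ (pathDist X) fun _ _ _ _ h h' => pathDist_congr h h'
  dist_self := by
    rintro ⟨a⟩
    exact pathDist_of_rel ((glueSetoid X).refl a)
  dist_comm := by
    rintro ⟨a⟩ ⟨b⟩
    exact pathDist_comm a b
  dist_triangle := by
    rintro ⟨a⟩ ⟨b⟩ ⟨c⟩
    exact pathDist_triangle a b c
  eq_of_dist_eq_zero := by
    rintro ⟨⟨n, x⟩⟩ ⟨⟨m, y⟩⟩ h
    exact tmk_eq_of_pathDist_eq_zero h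

theorem dist_tmk (n m : N) (x y : X.carrier) :
    dist (tmk n x) (tmk m y) = pathDist X (n, x) (m, y) := rfl

theorem dist_tmk_same_le (n : N) (x y : X.carrier) :
    dist (tmk n x) (tmk n y) ≤ dist x y / 3 := by
  rw [dist_tmk]
  refine (pathDist_le_step _ _).trans ((step_le_cellDist X _ _).trans ?_)
  simp [cellDist]

/-! ### The square metric space `N ⊗ X` -/

/-- The index of the third of `[0,1]` that contains `t`. -/
noncomputable def third (t : ℝ) : Fin 3 := if t ≤ 1 / 3 then 0 else if t ≤ 2 / 3 then 1 else 2

theorem third_zero : third 0 = 0 := by simp [third]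

theorem third_one : third 1 = 2 := by norm_num [third]

theorem third_mem {t : ℝ} (ht : t ∈ Set.Icc (0 : ℝ) 1) :
    3 * t - (third t).val ∈ Set.Icc (0 : ℝ) 1 := by
  have h1 := ht.1
  have h2 := ht.2
  unfold third
  split_ifs <;> constructor <;> norm_num <;> linarith

theorem third_boundary {t : ℝ} (ht : t = 0 ∨ t = 1) :
    3 * t - (third t).val = 0 ∨ 3 * t - (third t).val = 1 := by
  rcases ht with rfl | rfl
  · left; simp [third_zero]
  · right; rw [third_one]; norm_num

/-- The position inside its cell of a boundary point of the large square. -/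
noncomputable def zoom (p : M0) : M0 :=
  ⟨(3 * p.1.1 - (third p.1.1).val, 3 * p.1.2 - (third p.1.2).val), by
    obtain ⟨p, (⟨h, h'⟩ | ⟨h, h'⟩)⟩ := p
    · exact Or.inl ⟨third_boundary h, third_mem h'⟩
    · exact Or.inr ⟨third_mem h, third_boundary h'⟩⟩

/-- The boundary map of `N ⊗ X`: the boundary point `(r, s)` goes to
`(i, j) ⊗ S (3 r - i, 3 s - j)`, where `(i, j)` is a cell that contains `(r, s)`. (If several cells
contain `(r, s)`, all of them give the same element, see `tensorS_eq`.) -/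
noncomputable def tensorS (X : SquaMS.{u}) (p : M0) : Tensor X :=
  tmk (third p.1.1, third p.1.2) (X.S (zoom p))

theorem pos_zoom (p : M0) :
    pos (third p.1.1, third p.1.2) (zoom p) = (3 * p.1.1, 3 * p.1.2) := by
  simp [pos, zoom]

theorem tensorS_eq (n : N) (p q : M0) (h1 : (n.1.val : ℝ) + q.1.1 = 3 * p.1.1)
    (h2 : (n.2.val : ℝ) + q.1.2 = 3 * p.1.2) : tensorS X p = tmk n (X.S q) := by
  apply tmk_eq_of_pos_eq
  rw [pos_zoom]
  exact Prod.ext h1.symm h2.symm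

theorem taxi_le_dist_tensorS (p q : M0) :
    |p.1.1 - q.1.1| + |p.1.2 - q.1.2| ≤ dist (tensorS X p) (tensorS X q) := by
  have := taxi_le_pathDist (X := X) (third p.1.1, third p.1.2) (third q.1.1, third q.1.2)
    (zoom p) (zoom q)
  rw [pos_zoom, pos_zoom] at this
  simp only [← mul_sub, abs_mul] at this
  rw [abs_of_pos (show (0 : ℝ) < 3 by norm_num), ← mul_add, mul_div_cancel_left₀ _ (by norm_num)]
    at this
  exact this

/-- A map on the unit interval that is short on each third is short. -/
theorem short_of_thirds {Y : Type*} [PseudoMetricSpace Y] (f : ℝ → Y)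
    (h : ∀ (i : Fin 3) (a b : ℝ), 3 * a - i.val ∈ Set.Icc (0 : ℝ) 1 →
      3 * b - i.val ∈ Set.Icc (0 : ℝ) 1 → dist (f a) (f b) ≤ |b - a|)
    (a b : ℝ) (ha : a ∈ Set.Icc (0 : ℝ) 1) (hb : b ∈ Set.Icc (0 : ℝ) 1) :
    dist (f a) (f b) ≤ |b - a| := by
  wlog hab : a ≤ b generalizing a b
  · rw [dist_comm, abs_sub_comm]
    exact this b a hb ha (le_of_not_ge hab)
  rw [abs_of_nonneg (sub_nonneg.2 hab)]
  have H : ∀ (i : Fin 3) (a b : ℝ), a ≤ b → 3 * a - i.val ∈ Set.Icc (0 : ℝ) 1 →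
      3 * b - i.val ∈ Set.Icc (0 : ℝ) 1 → dist (f a) (f b) ≤ b - a := by
    intro i a b hab h1 h2
    have := h i a b h1 h2
    rwa [abs_of_nonneg (sub_nonneg.2 hab)] at this
  obtain ⟨ha0, ha1⟩ := ha
  obtain ⟨hb0, hb1⟩ := hb
  have H0 := fun a b (hab : a ≤ b) (h1 : 0 ≤ a) (h2 : b ≤ 1 / 3) =>
    H 0 a b hab (by norm_num; constructor <;> linarith) (by norm_num; constructor <;> linarith)
  have H1 := fun a b (hab : a ≤ b) (h1 : 1 / 3 ≤ a) (h2 : b ≤ 2 / 3) =>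
    H 1 a b hab (by norm_num; constructor <;> linarith) (by norm_num; constructor <;> linarith)
  have H2 := fun a b (hab : a ≤ b) (h1 : 2 / 3 ≤ a) (h2 : b ≤ 1) =>
    H 2 a b hab (by norm_num; constructor <;> linarith) (by norm_num; constructor <;> linarith)
  have T1 := dist_triangle (f a) (f (1 / 3)) (f b)
  have T2 := dist_triangle (f a) (f (2 / 3)) (f b)
  have T3 := dist_triangle (f a) (f (1 / 3)) (f (2 / 3))
  rcases le_total a (1 / 3) with h1 | h1
  · rcases le_total b (1 / 3) with h2 | h2
    · exact H0 a b hab ha0 h2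
    · have := H0 a (1 / 3) h1 ha0 le_rfl
      rcases le_total b (2 / 3) with h3 | h3
      · have := H1 (1 / 3) b h2 le_rfl h3
        linarith
      · have := H1 (1 / 3) (2 / 3) (by norm_num) le_rfl le_rfl
        have := H2 (2 / 3) b h3 le_rfl hb1
        linarith
  · rcases le_total a (2 / 3) with h2 | h2
    · rcases le_total b (2 / 3) with h3 | h3
      · exact H1 a b hab h1 h3
      · have := H1 a (2 / 3) h2 h1 le_rfl
        have := H2 (2 / 3) b h3 le_rfl hb1
        linarith
    · exact H2 a b hab h2 hb1

/-- A side of the large square is short, because it consists of three sides of cells. -/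
theorem side_short (X : SquaMS.{u}) (e : ℝ → M0) (j : Fin 3 → N)
    (hj : ∀ (i : Fin 3) (t : ℝ), 3 * t - i.val ∈ Set.Icc (0 : ℝ) 1 →
      tensorS X (e t) = tmk (j i) (X.S (e (3 * t - i.val))))
    (he : ∀ s ∈ Set.Icc (0 : ℝ) 1, ∀ t ∈ Set.Icc (0 : ℝ) 1,
      dist (X.S (e s)) (X.S (e t)) = |t - s|)
    (a b : ℝ) (ha : a ∈ Set.Icc (0 : ℝ) 1) (hb : b ∈ Set.Icc (0 : ℝ) 1) :
    dist (tensorS X (e a)) (tensorS X (e b)) ≤ |b - a| := by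
  refine short_of_thirds (fun t => tensorS X (e t)) (fun i a b ha hb => ?_) a b ha hb
  simp only [hj i a ha, hj i b hb]
  refine (dist_tmk_same_le _ _ _).trans ?_
  rw [he _ ha _ hb, sub_sub_sub_cancel_right, ← mul_sub, abs_mul,
    abs_of_pos (show (0 : ℝ) < 3 by norm_num), mul_div_cancel_left₀ _ (by norm_num)]

/-- The point of the unit interval closest to `t`. -/
noncomputable def clamp (t : ℝ) : unitInterval := Set.projIcc 0 1 zero_le_one t

theorem clamp_of_mem {t : ℝ} (ht : t ∈ Set.Icc (0 : ℝ) 1) : (clamp t : ℝ) = t := by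
  rw [clamp, Set.projIcc_of_mem _ ht]

theorem mem_of_third {t : ℝ} {i : Fin 3} (h : 3 * t - i.val ∈ Set.Icc (0 : ℝ) 1) :
    t ∈ Set.Icc (0 : ℝ) 1 := by
  have hi : (i.val : ℝ) ≤ 2 := by exact_mod_cast Nat.le_of_lt_succ i.2
  have hi' : (0 : ℝ) ≤ i.val := Nat.cast_nonneg _
  constructor <;> linarith [h.1, h.2]

theorem third_add_self {c : ℝ} (hc : c = 0 ∨ c = 1) : ((third c).val : ℝ) + c = 3 * c := by
  rcases hc with rfl | rfl
  · simp [third_zero]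
  · rw [third_one]; norm_num

theorem dist_tensorS_vertical (p q : M0) (h : p.1.1 = q.1.1) (h' : p.1.1 = 0 ∨ p.1.1 = 1) :
    dist (tensorS X p) (tensorS X q) = |q.1.2 - p.1.2| := by
  apply le_antisymm
  · let e : ℝ → M0 := fun t => ⟨(p.1.1, clamp t), Or.inl ⟨h', (clamp t).2⟩⟩
    have hp : e p.1.2 = p := Subtype.ext (Prod.ext rfl (clamp_of_mem p.snd_mem))
    have hq : e q.1.2 = q := Subtype.ext (Prod.ext h (clamp_of_mem q.snd_mem))
    have := side_short X e (fun i => (third p.1.1, i)) ?_ ?_ p.1.2 q.1.2 p.snd_mem q.snd_mem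
    · rwa [hp, hq] at this
    · intro i t ht
      refine tensorS_eq _ _ _ (third_add_self h') ?_
      simp only [e]
      rw [clamp_of_mem ht, clamp_of_mem (mem_of_third ht)]
      ring
    · intro s hs t ht
      rw [X.dist_vertical (e s) (e t) rfl h']
      simp only [e]
      rw [clamp_of_mem hs, clamp_of_mem ht]
  · have := taxi_le_dist_tensorS (X := X) p q
    rw [abs_sub_comm]
    exact (le_add_of_nonneg_left (abs_nonneg _)).trans this

theorem dist_tensorS_horizontal (p q : M0) (h : p.1.2 = q.1.2) (h' : p.1.2 = 0 ∨ p.1.2 = 1) :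
    dist (tensorS X p) (tensorS X q) = |q.1.1 - p.1.1| := by
  apply le_antisymm
  · let e : ℝ → M0 := fun t => ⟨(clamp t, p.1.2), Or.inr ⟨(clamp t).2, h'⟩⟩
    have hp : e p.1.1 = p := Subtype.ext (Prod.ext (clamp_of_mem p.fst_mem) rfl)
    have hq : e q.1.1 = q := Subtype.ext (Prod.ext (clamp_of_mem q.fst_mem) h)
    have := side_short X e (fun i => (i, third p.1.2)) ?_ ?_ p.1.1 q.1.1 p.fst_mem q.fst_mem
    · rwa [hp, hq] at this
    · intro i t ht
      refine tensorS_eq _ _ _ ?_ (third_add_self h')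
      simp only [e]
      rw [clamp_of_mem ht, clamp_of_mem (mem_of_third ht)]
      ring
    · intro s hs t ht
      rw [X.dist_horizontal (e s) (e t) rfl h']
      simp only [e]
      rw [clamp_of_mem hs, clamp_of_mem ht]
  · have := taxi_le_dist_tensorS (X := X) p q
    rw [abs_sub_comm]
    exact (le_add_of_nonneg_right (abs_nonneg _)).trans this

theorem injective_of_taxi_le {Y : Type*} [PseudoMetricSpace Y] (S : M0 → Y)
    (h : ∀ p q : M0, |p.1.1 - q.1.1| + |p.1.2 - q.1.2| ≤ dist (S p) (S q)) :
    Function.Injective S := by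
  intro p q hpq
  have h1 := h p q
  rw [hpq, dist_self] at h1
  have h2 := abs_nonneg (p.1.1 - q.1.1)
  have h3 := abs_nonneg (p.1.2 - q.1.2)
  apply Subtype.ext
  apply Prod.ext
  · exact sub_eq_zero.1 (abs_eq_zero.1 (by linarith))
  · exact sub_eq_zero.1 (abs_eq_zero.1 (by linarith))

/-- The square metric space `N ⊗ X`. -/
noncomputable def tensor (X : SquaMS.{u}) : SquaMS.{u} where
  carrier := Tensor X
  S := tensorS X
  S_injective := injective_of_taxi_le _ taxi_le_dist_tensorS
  dist_le_two := by
    rintro ⟨a⟩ ⟨b⟩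
    exact pathDist_le_two a b
  dist_vertical := dist_tensorS_vertical
  dist_horizontal := dist_tensorS_horizontal
  taxi_le_dist := taxi_le_dist_tensorS

/-! ### The functor `N ⊗ -` -/

/-- To define a short map on `N ⊗ X`, give a map on `N × X` that respects the identifications, is
`1/3`-Lipschitz on each copy and has an image of diameter at most `2`. -/
theorem lift_short {β : Type*} [PseudoMetricSpace β] {F : N × X.carrier → β}
    (hF : ∀ a b, Glue X a b → F a = F b)
    (hcell : ∀ n x y, dist (F (n, x)) (F (n, y)) ≤ dist x y / 3)
    (hbdd : ∀ a b, dist (F a) (F b) ≤ 2) (a b : Tensor X) :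
    dist (Quotient.lift F (fun _ _ h => eq_of_rel hF h) a : β)
      (Quotient.lift F (fun _ _ h => eq_of_rel hF h) b) ≤ dist a b := by
  induction a using Quotient.inductionOn
  induction b using Quotient.inductionOn
  exact dist_le_pathDist hF hcell hbdd _ _

variable {Y} in
theorem tensorMap_respects (f : X ⟶ Y) (a b : N × X.carrier) (h : Glue X a b) :
    tmk a.1 (f.toFun a.2) = tmk b.1 (f.toFun b.2) := by
  obtain ⟨n, _⟩ := a
  obtain ⟨m, _⟩ := b
  obtain ⟨p, q, h, rfl, rfl⟩ := h
  simp only [f.map_S]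
  exact tmk_eq_of_glue h

variable {Y} in
/-- The morphism `N ⊗ f`, that takes `n ⊗ x` to `n ⊗ f x`. -/
noncomputable def tensorMap (f : X ⟶ Y) : tensor X ⟶ tensor Y where
  toFun := Quotient.lift (fun a : N × X.carrier => tmk a.1 (f.toFun a.2))
    fun _ _ h => eq_of_rel (tensorMap_respects f) h
  short := lift_short (tensorMap_respects f)
    (fun n x y => (dist_tmk_same_le n _ _).trans
      (div_le_div_of_nonneg_right (f.short x y) (by norm_num)))
    (fun a b => (tensor Y).dist_le_two _ _)
  map_S := fun p => congrArg (tmk (third p.1.1, third p.1.2)) (f.map_S (zoom p))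

/-- The functor `N ⊗ -` on square metric spaces. -/
noncomputable def nTensor : SquaMS.{u} ⥤ SquaMS.{u} where
  obj X := tensor X
  map f := tensorMap f
  map_id _ := SquaMS.Hom.ext (funext fun a => Quotient.inductionOn a fun _ => rfl)
  map_comp _ _ := SquaMS.Hom.ext (funext fun a => Quotient.inductionOn a fun _ => rfl)

/-! ### The Cauchy completion functor -/

open UniformSpace in
/-- The Cauchy completion of a square metric space. -/
noncomputable def completion (X : SquaMS.{u}) : SquaMS.{u} where
  carrier := Completion X.carrier
  S p := (X.S p : Completion X.carrier)
  S_injective := injective_of_taxi_le _ fun p q => by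
    rw [Completion.dist_eq]
    exact X.taxi_le_dist p q
  dist_le_two x y := by
    induction x, y using Completion.induction_on₂ with
    | hp => exact isClosed_le continuous_dist continuous_const
    | ih x y =>
      rw [Completion.dist_eq]
      exact X.dist_le_two x y
  dist_vertical p q h h' := by
    rw [Completion.dist_eq]
    exact X.dist_vertical p q h h'
  dist_horizontal p q h h' := by
    rw [Completion.dist_eq]
    exact X.dist_horizontal p q h h'
  taxi_le_dist p q := by
    rw [Completion.dist_eq]
    exact X.taxi_le_dist p q

variable {Y} in
theorem SquaMS.Hom.lipschitz (f : X ⟶ Y) : LipschitzWith 1 f.toFun :=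
  LipschitzWith.of_dist_le_mul fun x y => by simpa using f.short x y

open UniformSpace in
/-- The Cauchy completion functor on square metric spaces; `C(f)` is the continuous extension
of `f`. -/
noncomputable def completionFunctor : SquaMS.{u} ⥤ SquaMS.{u} where
  obj X := completion X
  map {X Y} f :=
    { toFun := Completion.map f.toFun
      short := fun x y =>
        ((SquaMS.Hom.lipschitz f).completion_map.dist_le_mul x y).trans
          (one_mul (dist x y)).le
      map_S := fun p => by
        refine (Completion.map_coe (SquaMS.Hom.lipschitz f).uniformContinuous _).trans ?_
        rw [f.map_S]
        rfl }
  map_id X := SquaMS.Hom.ext Completion.map_id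
  map_comp f g := SquaMS.Hom.ext (Completion.map_comp
    (SquaMS.Hom.lipschitz g).uniformContinuous (SquaMS.Hom.lipschitz f).uniformContinuous).symm

/-! ### The comparison `N ⊗ C X ⟶ C (N ⊗ X)` -/

theorem tmk_lipschitz (n : N) : LipschitzWith (1 / 3) (tmk (X := X) n) :=
  LipschitzWith.of_dist_le_mul fun x y => by
    exact (dist_tmk_same_le n x y).trans (le_of_eq (one_div_mul_eq_div (3 : ℝ) _).symm)

open UniformSpace in
/-- The map `N × C X → C (N ⊗ X)` that takes `(n, lim xₖ)` to `lim (n ⊗ xₖ)`. -/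
noncomputable def comparisonFun (X : SquaMS.{u}) (a : N × (completion X).carrier) :
    Completion (Tensor X) :=
  Completion.map (tmk (X := X) a.1) a.2

open UniformSpace in
theorem comparisonFun_coe (n : N) (x : X.carrier) :
    comparisonFun X (n, (x : Completion X.carrier)) = (tmk n x : Completion (Tensor X)) :=
  Completion.map_coe (tmk_lipschitz n).uniformContinuous x

theorem comparisonFun_respects (a b : N × (completion X).carrier) (h : Glue (completion X) a b) :
    comparisonFun X a = comparisonFun X b := by
  obtain ⟨n, _⟩ := a
  obtain ⟨m, _⟩ := b
  obtain ⟨p, q, h, rfl, rfl⟩ := h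
  refine (comparisonFun_coe n (X.S p)).trans
    (Eq.trans ?_ (comparisonFun_coe m (X.S q)).symm)
  rw [tmk_eq_of_glue h]

/-- The morphism `N ⊗ C X ⟶ C (N ⊗ X)` that takes `n ⊗ lim xₖ` to `lim (n ⊗ xₖ)`. -/
noncomputable def comparison (X : SquaMS.{u}) :
    nTensor.obj (completionFunctor.obj X) ⟶ completionFunctor.obj (nTensor.obj X) where
  toFun := Quotient.lift (comparisonFun X) fun _ _ h => eq_of_rel comparisonFun_respects h
  short := lift_short comparisonFun_respects
    (fun n x y => ((tmk_lipschitz n).completion_map.dist_le_mul x y).trans (le_of_eq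
      (one_div_mul_eq_div (3 : ℝ) (dist x y))))
    (fun _ _ => (completion (tensor X)).dist_le_two _ _)
  map_S := fun _ => comparisonFun_coe _ _

/-- For an algebra `λ : N ⊗ W ⟶ W`, the induced algebra structure `θ = C(λ) ∘ i : N ⊗ V ⟶ V` on
the Cauchy completion `V = C W`, where `i : N ⊗ C W ⟶ C (N ⊗ W)` is the comparison morphism. -/
noncomputable def theta (A : Endofunctor.Algebra nTensor.{u}) :
    nTensor.obj (completionFunctor.obj A.a) ⟶ completionFunctor.obj A.a :=
  comparison A.a ≫ completionFunctor.map A.str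

/-! ### The unit square with the taxicab metric -/

/-- The unit square `[0,1]²` (in the universe `u`). -/
@[ext]
structure UnitSquare : Type u where
  fst : unitInterval
  snd : unitInterval

/-- The taxicab metric on the unit square. -/
noncomputable instance : MetricSpace UnitSquare.{u} where
  dist p q := |(p.fst : ℝ) - q.fst| + |(p.snd : ℝ) - q.snd|
  dist_self p := by simp
  dist_comm p q := by simp only [abs_sub_comm]
  dist_triangle p q r := by
    have h1 := abs_sub_le (p.fst : ℝ) q.fst r.fst
    have h2 := abs_sub_le (p.snd : ℝ) q.snd r.snd
    linarith
  eq_of_dist_eq_zero := by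
    intro p q h
    change |(p.fst : ℝ) - q.fst| + |(p.snd : ℝ) - q.snd| = 0 at h
    have h1 := abs_nonneg ((p.fst : ℝ) - q.fst)
    have h2 := abs_nonneg ((p.snd : ℝ) - q.snd)
    apply UnitSquare.ext
    · exact Subtype.ext (sub_eq_zero.1 (abs_eq_zero.1 (by linarith)))
    · exact Subtype.ext (sub_eq_zero.1 (abs_eq_zero.1 (by linarith)))

theorem UnitSquare.dist_def (p q : UnitSquare.{u}) :
    dist p q = |(p.fst : ℝ) - q.fst| + |(p.snd : ℝ) - q.snd| := rfl

/-- The square metric space `U₀`: the unit square with the taxicab metric and the inclusion of its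
boundary. -/
noncomputable def U0 : SquaMS.{u} where
  carrier := UnitSquare.{u}
  S p := ⟨⟨p.1.1, p.fst_mem⟩, ⟨p.1.2, p.snd_mem⟩⟩
  S_injective := injective_of_taxi_le _ fun p q => by rw [UnitSquare.dist_def]
  dist_le_two p q := by
    rw [UnitSquare.dist_def]
    have h1 : |(p.fst : ℝ) - q.fst| ≤ 1 := abs_sub_le_iff.2
      ⟨by linarith [p.fst.2.2, q.fst.2.1], by linarith [p.fst.2.1, q.fst.2.2]⟩
    have h2 : |(p.snd : ℝ) - q.snd| ≤ 1 := abs_sub_le_iff.2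
      ⟨by linarith [p.snd.2.2, q.snd.2.1], by linarith [p.snd.2.1, q.snd.2.2]⟩
    linarith
  dist_vertical p q h h' := by
    rw [UnitSquare.dist_def]
    simp [h, abs_sub_comm]
  dist_horizontal p q h h' := by
    rw [UnitSquare.dist_def]
    simp [h, abs_sub_comm]
  taxi_le_dist p q := by rw [UnitSquare.dist_def]

end SquareMetric

namespace SquareMetric

/-! Everything is compared with the unit square. Placing nine shrunken squares into the big one
gives `squareStr`, and this is an isomorphism `N ⊗ U₀ ≅ U₀`: cells meet only along their boundaries,
and the taxicab distance is the length of a path with one corner, whose two legs are cut by the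
cells into pieces that each stay in one cell (`isIso_squareStr`).

The square is a final coalgebra by Banach's argument. Coalgebra morphisms `B ⟶ U₀` are the fixed
points of `unfoldStep`, which contracts uniform distances by 1/3, and `U₀` is complete. The
iteration needs a starting morphism: taxicab distance in the plane is the maximum distance in the
coordinates `r + s` and `r - s`, so two extensions of real-valued short functions provide one
(`nonempty_hom_U0`).

The initial algebra is `grid`, the points with at least one triadic coordinate: what the nine cell
maps generate from the boundary. A morphism to an algebra `Y` is forced on these points, and the
inductive relation `Graph` records the forced values. It is single-valued because ambiguity occurs
only on glued cell boundaries (`Graph.unique`). It is short along each triadic line by induction on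
the triadic coordinate, and short altogether because paths along triadic lines approximate the
taxicab distance (`Graph.dist_le`).

The grid is dense in the square, so the completion of any initial algebra is `U₀`. This isomorphism
carries `theta` to `squareStr` (`theta_comp_completionDesc`), and finality transfers. -/

/-! ### Isomorphisms of square metric spaces and morphisms out of `N ⊗ X` -/

theorem isIso_of_isometry {X Y : SquaMS.{u}} (f : X ⟶ Y) (hf : Isometry f.toFun)
    (hs : Function.Surjective f.toFun) : IsIso f := by
  let e := Equiv.ofBijective f.toFun ⟨hf.injective, hs⟩
  have he : ∀ y, f.toFun (e.symm y) = y := e.apply_symm_apply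
  refine ⟨⟨⟨e.symm, fun x y => ?_, fun p => ?_⟩, ?_, ?_⟩⟩
  · rw [← hf.dist_eq, he, he]
  · rw [← f.map_S p]
    exact e.symm_apply_apply _
  · exact SquaMS.Hom.ext (funext e.symm_apply_apply)
  · exact SquaMS.Hom.ext (funext he)

/-- The morphism `N ⊗ X ⟶ Y` induced by a map on `N × X`. -/
noncomputable def tensorDesc {X Y : SquaMS.{u}} (F : N × X.carrier → Y.carrier)
    (hF : ∀ n m p q, GridGlue (n, p) (m, q) → F (n, X.S p) = F (m, X.S q))
    (hcell : ∀ n x y, dist (F (n, x)) (F (n, y)) ≤ dist x y / 3)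
    (hS : ∀ p, F ((third p.1.1, third p.1.2), X.S (zoom p)) = Y.S p) : tensor X ⟶ Y :=
  have hF' : ∀ a b, Glue X a b → F a = F b := by
    rintro ⟨n, _⟩ ⟨m, _⟩ ⟨p, q, h, rfl, rfl⟩
    exact hF n m p q h
  { toFun := Quotient.lift F fun _ _ h => eq_of_rel hF' h
    short := lift_short hF' hcell fun _ _ => Y.dist_le_two _ _
    map_S := hS }

theorem tensor_hom_ext {X Y : SquaMS.{u}} {f g : tensor X ⟶ Y}
    (h : ∀ n x, f.toFun (tmk n x) = g.toFun (tmk n x)) : f = g :=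
  SquaMS.Hom.ext (funext fun a => Quotient.inductionOn a fun b => h b.1 b.2)

/-! ### The unit square is a fixed point of `N ⊗ -` -/

/-- The image of `t` in the `i`-th third of the unit interval. -/
noncomputable def shrink (i : Fin 3) (t : unitInterval) : unitInterval :=
  ⟨(i.val + t) / 3, by
    have hi : (i.val : ℝ) ≤ 2 := by exact_mod_cast Nat.le_of_lt_succ i.2
    have hi' : (0 : ℝ) ≤ i.val := Nat.cast_nonneg _
    constructor <;> linarith [t.2.1, t.2.2]⟩

/-- The position of `t` inside its third of the unit interval. -/
noncomputable def expand (t : unitInterval) : unitInterval :=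
  ⟨3 * t - (third t).val, third_mem t.2⟩

theorem shrink_third_expand (t : unitInterval) : shrink (third t) (expand t) = t :=
  Subtype.ext (by simp [shrink, expand])

theorem shrink_clamp {i : Fin 3} {t : ℝ} (h : 3 * t - i.val ∈ Set.Icc (0 : ℝ) 1) :
    shrink i (clamp (3 * t - i.val)) = clamp t := by
  apply Subtype.ext
  rw [clamp_of_mem (mem_of_third h)]
  simp [shrink, clamp_of_mem h]

/-- Distinct thirds of the interval share at most an endpoint. -/
theorem shrink_eq_cases {i k : Fin 3} {r t : unitInterval} (h : shrink i r = shrink k t) :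
    (i = k ∧ r = t) ∨ ((r = 0 ∨ r = 1) ∧ (t = 0 ∨ t = 1)) := by
  have h' : (i.val : ℝ) + r = k.val + t := by
    have := congrArg Subtype.val h
    simp only [shrink] at this
    linarith
  rcases coord_cases r.2 t.2 h' with ⟨h1, h2⟩ | ⟨-, h1, h2⟩ | ⟨-, h1, h2⟩
  · exact Or.inl ⟨Fin.ext h1, Subtype.ext h2⟩
  · exact Or.inr ⟨Or.inr (Subtype.ext h1), Or.inl (Subtype.ext h2)⟩
  · exact Or.inr ⟨Or.inl (Subtype.ext h2), Or.inr (Subtype.ext h1)⟩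

/-- The position in the large square of the point `u` of the cell `n`. -/
noncomputable def cellPoint (n : N) (u : UnitSquare.{u}) : UnitSquare.{u} :=
  ⟨shrink n.1 u.fst, shrink n.2 u.snd⟩

theorem dist_cellPoint (n : N) (u v : UnitSquare.{u}) :
    dist (cellPoint n u) (cellPoint n v) = dist u v / 3 := by
  simp only [UnitSquare.dist_def, cellPoint, shrink]
  rw [← sub_div, ← sub_div, add_sub_add_left_eq_sub, add_sub_add_left_eq_sub, abs_div, abs_div,
    abs_of_pos (show (0 : ℝ) < 3 by norm_num), add_div]

theorem cellPoint_S_eq_iff {n m : N} {p q : M0} :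
    cellPoint n (U0.{u}.S p) = cellPoint m (U0.{u}.S q) ↔ pos n p = pos m q := by
  simp [cellPoint, UnitSquare.ext_iff, pos, Prod.ext_iff, shrink, U0, Subtype.ext_iff,
    div_left_inj']

theorem cellPoint_third_zoom (p : M0) :
    cellPoint (third p.1.1, third p.1.2) (U0.{u}.S (zoom p)) = U0.{u}.S p := by
  simp [cellPoint, shrink, U0, zoom]

theorem cellPoint_third_expand (u : UnitSquare.{u}) :
    cellPoint (third u.fst, third u.snd) ⟨expand u.fst, expand u.snd⟩ = u := by
  simp [cellPoint, shrink_third_expand]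

theorem exists_S_eq {u : UnitSquare.{u}}
    (h : (u.fst = 0 ∨ u.fst = 1) ∨ (u.snd = 0 ∨ u.snd = 1)) : ∃ p, U0.{u}.S p = u := by
  refine ⟨⟨(u.fst, u.snd), ?_⟩, rfl⟩
  rcases h with h | h
  · exact Or.inl ⟨h.imp (congrArg Subtype.val) (congrArg Subtype.val), u.snd.2⟩
  · exact Or.inr ⟨u.fst.2, h.imp (congrArg Subtype.val) (congrArg Subtype.val)⟩

/-- Distinct cells meet only in their boundaries: a single coordinate lying in two different thirds
already puts both local points on a side. Both the injectivity of `squareStr` and the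
single-valuedness of `Graph` rest on this. -/
theorem cellPoint_eq_cases {n m : N} {u v : UnitSquare.{u}} (h : cellPoint n u = cellPoint m v) :
    (n = m ∧ u = v) ∨ ∃ p q, U0.{u}.S p = u ∧ U0.{u}.S q = v ∧ pos n p = pos m q := by
  have key : ((u.fst = 0 ∨ u.fst = 1) ∨ (u.snd = 0 ∨ u.snd = 1)) →
      ((v.fst = 0 ∨ v.fst = 1) ∨ (v.snd = 0 ∨ v.snd = 1)) →
      ∃ p q, U0.{u}.S p = u ∧ U0.{u}.S q = v ∧ pos n p = pos m q := by
    intro hu hv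
    obtain ⟨p, rfl⟩ := exists_S_eq hu
    obtain ⟨q, rfl⟩ := exists_S_eq hv
    exact ⟨p, q, rfl, rfl, cellPoint_S_eq_iff.1 h⟩
  rcases shrink_eq_cases (congrArg UnitSquare.fst h) with ⟨h1, h2⟩ | ⟨h1, h2⟩
  · rcases shrink_eq_cases (congrArg UnitSquare.snd h) with ⟨h3, h4⟩ | ⟨h3, h4⟩
    · exact Or.inl ⟨Prod.ext h1 h3, UnitSquare.ext h2 h4⟩
    · exact Or.inr (key (Or.inr h3) (Or.inr h4))
  · exact Or.inr (key (Or.inl h1) (Or.inl h2))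

theorem tmk_eq_of_cellPoint_eq {n m : N} {u v : UnitSquare.{u}}
    (h : cellPoint n u = cellPoint m v) : tmk (X := U0.{u}) n u = tmk m v := by
  rcases cellPoint_eq_cases h with ⟨rfl, rfl⟩ | ⟨p, q, rfl, rfl, hpq⟩
  · rfl
  · exact tmk_eq_of_pos_eq hpq

/-- The morphism `N ⊗ U₀ ⟶ U₀` that takes a point of a cell to its position in the square. -/
noncomputable def squareStr : nTensor.obj U0.{u} ⟶ U0.{u} :=
  tensorDesc (fun a => cellPoint a.1 a.2)
    (fun _ _ _ _ h => cellPoint_S_eq_iff.2 (pos_eq_of_glue h))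
    (fun n x y => (dist_cellPoint n x y).le) cellPoint_third_zoom

/-- A map on the unit square that is short along each of the sides of the rectangle with opposite
vertices `u` and `v` does not increase their distance. -/
theorem dist_le_of_corner {Y : Type*} [PseudoMetricSpace Y] (f : UnitSquare.{u} → Y)
    (hv : ∀ r s s', dist (f ⟨r, s⟩) (f ⟨r, s'⟩) ≤ dist s s')
    (hh : ∀ s r r', dist (f ⟨r, s⟩) (f ⟨r', s⟩) ≤ dist r r') (u v : UnitSquare.{u}) :
    dist (f u) (f v) ≤ dist u v := by
  have h1 := hv u.fst u.snd v.snd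
  have h2 := hh v.snd u.fst v.fst
  refine (dist_triangle _ (f ⟨u.fst, v.snd⟩) _).trans ?_
  rw [UnitSquare.dist_def, add_comm]
  exact add_le_add h2 h1

/-- The factor 1/3 in `hg` cancels the stretching of a third to the whole interval, so `f` is short
on each third, and thirds concatenate. -/
theorem unitInterval_dist_le_of_thirds {Y : Type*} [PseudoMetricSpace Y] (f : unitInterval → Y)
    (g : Fin 3 → unitInterval → Y) (hfg : ∀ i t, f (shrink i t) = g i t)
    (hg : ∀ i s t, dist (g i s) (g i t) ≤ dist s t / 3) (s t : unitInterval) :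
    dist (f s) (f t) ≤ dist s t := by
  have := short_of_thirds (fun x => f (clamp x)) (fun i a b ha hb => ?_) s t s.2 t.2
  · simp only [clamp, Set.projIcc_val] at this
    rwa [dist_comm s t, Subtype.dist_eq, Real.dist_eq]
  · rw [← shrink_clamp ha, ← shrink_clamp hb, hfg, hfg]
    refine (hg _ _ _).trans (le_of_eq ?_)
    rw [Subtype.dist_eq, clamp_of_mem ha, clamp_of_mem hb, dist_comm, Real.dist_eq,
      sub_sub_sub_cancel_right, ← mul_sub, abs_mul, abs_of_pos (show (0 : ℝ) < 3 by norm_num),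
      mul_div_cancel_left₀ _ (by norm_num)]

theorem dist_vertical_eq (r s s' : unitInterval) :
    dist (⟨r, s⟩ : UnitSquare.{u}) ⟨r, s'⟩ = dist s s' := by
  rw [UnitSquare.dist_def, sub_self, abs_zero, zero_add]
  rfl

theorem dist_horizontal_eq (s r r' : unitInterval) :
    dist (⟨r, s⟩ : UnitSquare.{u}) ⟨r', s⟩ = dist r r' := by
  rw [UnitSquare.dist_def, sub_self, abs_zero, add_zero]
  rfl

/-- The inverse picks some cell containing the point. The substance is that it is short: a
horizontal or vertical segment passes through at most three cells of one row or column, and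
`dist_le_of_corner` combines the two directions. -/
instance isIso_squareStr : IsIso squareStr.{u} := by
  let split : UnitSquare.{u} → Tensor U0.{u} := fun u =>
    tmk (third u.fst, third u.snd) ⟨expand u.fst, expand u.snd⟩
  -- The cell chosen by `third` need not be `n`, but all cells containing the point give the same
  -- class.
  have hsplit : ∀ n u, split (cellPoint n u) = tmk n u := fun n u =>
    tmk_eq_of_cellPoint_eq (cellPoint_third_expand _)
  have hshort : ∀ u v, dist (split u) (split v) ≤ dist u v := by
    refine dist_le_of_corner split (fun r => ?_) (fun s => ?_)
    · refine unitInterval_dist_le_of_thirds (fun s => split ⟨r, s⟩)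
        (fun j s => tmk (third r, j) ⟨expand r, s⟩) (fun j s => ?_) (fun j s t => ?_)
      · rw [← hsplit, cellPoint, shrink_third_expand]
      · refine (dist_tmk_same_le (X := U0.{u}) _ _ _).trans (le_of_eq ?_)
        exact congrArg (· / 3) (dist_vertical_eq _ _ _)
    · refine unitInterval_dist_le_of_thirds (fun r => split ⟨r, s⟩)
        (fun i r => tmk (i, third s) ⟨r, expand s⟩) (fun j s => ?_) (fun j s t => ?_)
      · rw [← hsplit, cellPoint, shrink_third_expand]
      · refine (dist_tmk_same_le (X := U0.{u}) _ _ _).trans (le_of_eq ?_)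
        exact congrArg (· / 3) (dist_horizontal_eq _ _ _)
  refine ⟨⟨⟨split, hshort, fun p => ?_⟩, ?_, ?_⟩⟩
  · exact tmk_eq_of_cellPoint_eq
      ((cellPoint_third_expand (U0.{u}.S p)).trans (cellPoint_third_zoom p).symm)
  · exact tensor_hom_ext fun n u => hsplit n u
  · exact SquaMS.Hom.ext (funext cellPoint_third_expand)

/-! ### The unit square is a final coalgebra -/

/-- The unit square with the taxicab metric is an absolute short retract. -/
theorem nonempty_hom_U0 (X : SquaMS.{u}) : Nonempty (X ⟶ U0.{u}) := by
  -- On the boundary `f` is `r + s` and `g` is `r - s`; half their sum and half their difference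
  -- recover the coordinates. Off the boundary these may leave the unit interval, hence the
  -- clamping.
  obtain ⟨f, hf, hfS, -⟩ := exists_short X 1 1 abs_one abs_one
  obtain ⟨g, hg, hgS, -⟩ := exists_short X 1 (-1) abs_one (by simp)
  have hclamp : ∀ a b : ℝ, |(clamp a : ℝ) - clamp b| ≤ |a - b| := fun a b => by
    simpa [Subtype.dist_eq, Real.dist_eq, clamp] using
      (LipschitzWith.projIcc (zero_le_one' ℝ)).dist_le_mul a b
  refine ⟨⟨fun x => ⟨clamp ((f x + g x) / 2), clamp ((f x - g x) / 2)⟩, fun x y => ?_,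
    fun p => ?_⟩⟩
  · have h1 := hf x y
    have h2 := hg x y
    refine (add_le_add (hclamp _ _) (hclamp _ _)).trans ?_
    rw [Real.dist_eq, abs_le] at h1 h2
    -- In each sign pattern the sum of the two absolute values collapses to plus or minus an
    -- increment of `f` or of `g` alone.
    rcases abs_cases ((f x + g x) / 2 - (f y + g y) / 2) with ⟨e, _⟩ | ⟨e, _⟩ <;>
      rcases abs_cases ((f x - g x) / 2 - (f y - g y) / 2) with ⟨e', _⟩ | ⟨e', _⟩ <;>
      rw [e, e'] <;> linarith [h1.1, h1.2, h2.1, h2.2]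
  · refine UnitSquare.ext (Subtype.ext ?_) (Subtype.ext ?_)
    · have : (f (X.S p) + g (X.S p)) / 2 = p.1.1 := by rw [hfS, hgS]; ring
      simp only [this]
      exact clamp_of_mem p.fst_mem
    · have : (f (X.S p) - g (X.S p)) / 2 = p.1.2 := by rw [hfS, hgS]; ring
      simp only [this]
      exact clamp_of_mem p.snd_mem

/-- Serves to obtain completeness, which the fixed point iteration and the passage to the completion
use. -/
instance : CompactSpace UnitSquare.{u} := by
  have hc : Continuous fun p : unitInterval × unitInterval => (⟨p.1, p.2⟩ : UnitSquare.{u}) := by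
    refine LipschitzWith.continuous (K := 2) (LipschitzWith.of_dist_le_mul fun p q => ?_)
    have h1 : dist p.1 q.1 ≤ dist p q := le_max_left _ _
    have h2 : dist p.2 q.2 ≤ dist p q := le_max_right _ _
    rw [UnitSquare.dist_def, NNReal.coe_ofNat, two_mul]
    exact add_le_add h1 h2
  have hs : Function.Surjective
      fun p : unitInterval × unitInterval => (⟨p.1, p.2⟩ : UnitSquare.{u}) :=
    fun u => ⟨(u.fst, u.snd), rfl⟩
  exact hs.compactSpace hc

instance : CompleteSpace U0.{u}.carrier :=
  inferInstanceAs (CompleteSpace UnitSquare.{u})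

/-! ### Coalgebra morphisms as fixed points of a contraction -/

section

variable {B : SquaMS.{u}} (β : B ⟶ nTensor.obj B)

/-- The operator on morphisms `B ⟶ U₀` whose fixed points are the coalgebra morphisms. -/
noncomputable def unfoldStep (f : B ⟶ U0.{u}) : B ⟶ U0.{u} := β ≫ nTensor.map f ≫ squareStr

/-- Both maps place the image of `β x = n ⊗ y` in the same cell `n`, and placement in a cell scales
distances by 1/3. -/
theorem dist_unfoldStep_le {f g : B ⟶ U0.{u}} {c : ℝ}
    (h : ∀ x, dist (f.toFun x) (g.toFun x) ≤ c) (x : B.carrier) :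
    dist ((unfoldStep β f).toFun x) ((unfoldStep β g).toFun x) ≤ c / 3 := by
  have key : ∀ a : Tensor B, dist (squareStr.toFun ((nTensor.map f).toFun a))
      (squareStr.toFun ((nTensor.map g).toFun a)) ≤ c / 3 := by
    rintro ⟨n, y⟩
    exact (dist_cellPoint n _ _).trans_le (div_le_div_of_nonneg_right (h y) (by norm_num))
  exact key _

theorem dist_unfoldStep_iterate_le (f g : B ⟶ U0.{u}) (k : ℕ) (x : B.carrier) :
    dist (((unfoldStep β)^[k] f).toFun x) (((unfoldStep β)^[k] g).toFun x) ≤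
      2 * (1 / 3) ^ k := by
  induction k generalizing x with
  | zero => simpa using U0.{u}.dist_le_two _ _
  | succ k ih =>
    rw [Function.iterate_succ_apply', Function.iterate_succ_apply']
    refine (dist_unfoldStep_le β ih x).trans (le_of_eq ?_)
    ring

theorem eq_of_unfoldStep_eq {f g : B ⟶ U0.{u}} (hf : unfoldStep β f = f)
    (hg : unfoldStep β g = g) : f = g := by
  refine SquaMS.Hom.ext (funext fun x => dist_le_zero.1 ?_)
  have h : ∀ k : ℕ, dist (f.toFun x) (g.toFun x) ≤ 2 * (1 / 3) ^ k := fun k => by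
    have := dist_unfoldStep_iterate_le β f g k x
    rwa [Function.iterate_fixed hf, Function.iterate_fixed hg] at this
  have hlim : Filter.Tendsto (fun k : ℕ => (2 : ℝ) * (1 / 3) ^ k) Filter.atTop (nhds (2 * 0)) :=
    (tendsto_pow_atTop_nhds_zero_of_lt_one (by norm_num) (by norm_num)).const_mul 2
  rw [mul_zero] at hlim
  exact ge_of_tendsto' hlim h

/-- Banach iteration with pointwise limits, which inherit shortness and the boundary values. The
convergence rate is uniform in `x`; this matters because `unfoldStep` evaluates the iterates at
points other than `x`. -/
theorem exists_unfoldStep_eq : ∃ f : B ⟶ U0.{u}, unfoldStep β f = f := by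
  obtain ⟨f₀⟩ := nonempty_hom_U0 B
  let s : ℕ → (B ⟶ U0.{u}) := fun k => (unfoldStep β)^[k] f₀
  have hs : ∀ x k, dist ((s k).toFun x) ((s (k + 1)).toFun x) ≤ 2 * (1 / 3) ^ k := fun x k => by
    -- Starting the second orbit one step later makes it the shifted sequence.
    have := dist_unfoldStep_iterate_le β f₀ (unfoldStep β f₀) k x
    rwa [← Function.iterate_succ_apply] at this
  have hcauchy : ∀ x, CauchySeq fun k => (s k).toFun x := fun x =>
    cauchySeq_of_le_geometric (1 / 3) 2 (by norm_num) (hs x)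
  choose l hl using fun x => cauchySeq_tendsto_of_complete (hcauchy x)
  let f : B ⟶ U0.{u} :=
    { toFun := l
      short := fun x y => le_of_tendsto' ((hl x).dist (hl y)) fun k => (s k).short x y
      map_S := fun p => tendsto_nhds_unique (hl (B.S p)) <| by
        simp only [(s _).map_S]
        exact tendsto_const_nhds }
  refine ⟨f, SquaMS.Hom.ext (funext fun x => ?_)⟩
  -- The constant is the geometric sum `2 / (1 - 1/3) = 3`.
  have hle : ∀ k x, dist ((s k).toFun x) (f.toFun x) ≤ 3 * (1 / 3) ^ k := fun k x => by
    refine (dist_le_of_le_geometric_of_tendsto (1 / 3) 2 (by norm_num) (hs x) (hl x) k).trans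
      (le_of_eq ?_)
    ring
  have hlim : Filter.Tendsto (fun k => (s (k + 1)).toFun x) Filter.atTop
      (nhds ((unfoldStep β f).toFun x)) := by
    rw [tendsto_iff_dist_tendsto_zero]
    refine squeeze_zero (fun _ => dist_nonneg) (fun k => ?_)
      (g := fun k : ℕ => (3 : ℝ) * (1 / 3) ^ k / 3) ?_
    · simp only [s, Function.iterate_succ_apply']
      exact dist_unfoldStep_le β (hle k) x
    · simpa using (tendsto_pow_atTop_nhds_zero_of_lt_one (r := (1 / 3 : ℝ)) (by norm_num)
        (by norm_num)).const_mul 3 |>.div_const 3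
  exact tendsto_nhds_unique hlim ((hl x).comp (Filter.tendsto_add_atTop_nat 1))

end

/-- The unit square as a coalgebra. -/
noncomputable def squareCoalgebra : Endofunctor.Coalgebra nTensor.{u} where
  V := U0
  str := inv squareStr

theorem unfoldStep_eq_iff (B : Endofunctor.Coalgebra nTensor.{u}) (f : B.V ⟶ U0.{u}) :
    unfoldStep B.str f = f ↔ B.str ≫ nTensor.map f = f ≫ inv squareStr := by
  rw [IsIso.eq_comp_inv, Category.assoc]
  rfl

/-- The unit square is a final coalgebra. -/
noncomputable def squareCoalgebraIsTerminal : IsTerminal squareCoalgebra.{u} :=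
  IsTerminal.ofUniqueHom
    (fun B => ⟨(exists_unfoldStep_eq B.str).choose,
      (unfoldStep_eq_iff B _).1 (exists_unfoldStep_eq B.str).choose_spec⟩)
    fun B m => Endofunctor.Coalgebra.Hom.ext (eq_of_unfoldStep_eq B.str
      ((unfoldStep_eq_iff B _).2 m.h) (exists_unfoldStep_eq B.str).choose_spec)

/-! ### The triadic grid -/

/-- The triadic rational points of the unit interval. -/
inductive Triadic : unitInterval → Prop
  | zero : Triadic 0
  | one : Triadic 1
  | shrink (i : Fin 3) {t : unitInterval} (h : Triadic t) : Triadic (shrink i t)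

theorem dist_shrink (i : Fin 3) (s t : unitInterval) :
    dist (shrink i s) (shrink i t) = dist s t / 3 := by
  simp only [Subtype.dist_eq, Real.dist_eq, shrink]
  rw [← sub_div, add_sub_add_left_eq_sub, abs_div, abs_of_pos (show (0 : ℝ) < 3 by norm_num)]

/-- Splitting off one ternary digit of `s` divides the error by three. -/
theorem exists_triadic_dist_le (s : unitInterval) (k : ℕ) :
    ∃ t, Triadic t ∧ dist s t ≤ (1 / 3) ^ k := by
  induction k generalizing s with
  | zero =>
    refine ⟨0, Triadic.zero, ?_⟩
    rw [Subtype.dist_eq, pow_zero]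
    exact Real.dist_le_of_mem_Icc_01 s.2 unitInterval.zero_mem
  | succ k ih =>
    obtain ⟨t, ht, hd⟩ := ih (expand s)
    refine ⟨shrink (third s) t, ht.shrink _, ?_⟩
    have h : dist s (shrink (third s) t) = dist (expand s) t / 3 := by
      rw [← dist_shrink (third s), shrink_third_expand]
    rw [h, pow_succ]
    linarith

theorem exists_triadic_dist_lt (s : unitInterval) {ε : ℝ} (hε : 0 < ε) :
    ∃ t, Triadic t ∧ dist s t < ε := by
  obtain ⟨k, hk⟩ := exists_pow_lt_of_lt_one hε (show (1 / 3 : ℝ) < 1 by norm_num)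
  obtain ⟨t, ht, hd⟩ := exists_triadic_dist_le s k
  exact ⟨t, ht, hd.trans_lt hk⟩

/-- The points of the unit square with a triadic rational coordinate. -/
def OnGrid (u : UnitSquare.{u}) : Prop := Triadic u.fst ∨ Triadic u.snd

theorem OnGrid.cellPoint {u : UnitSquare.{u}} (h : OnGrid u) (n : N) : OnGrid (cellPoint n u) :=
  h.imp (fun h => h.shrink _) (fun h => h.shrink _)

theorem onGrid_S (p : M0) : OnGrid (U0.{u}.S p) := by
  have h : ∀ (x : ℝ) (hx : x ∈ Set.Icc (0 : ℝ) 1), x = 0 ∨ x = 1 → Triadic ⟨x, hx⟩ := by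
    rintro x hx (rfl | rfl)
    · exact Triadic.zero
    · exact Triadic.one
  rcases p.2 with ⟨h', -⟩ | ⟨-, h'⟩
  · exact Or.inl (h _ _ h')
  · exact Or.inr (h _ _ h')

/-- The points of the unit square with a triadic rational coordinate, with the taxicab metric. -/
noncomputable def grid : SquaMS.{u} where
  carrier := {u : UnitSquare.{u} // OnGrid u}
  S p := ⟨U0.S p, onGrid_S p⟩
  S_injective _ _ h := U0.{u}.S_injective (congrArg Subtype.val h)
  dist_le_two u v := U0.{u}.dist_le_two u.1 v.1
  dist_vertical := U0.{u}.dist_vertical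
  dist_horizontal := U0.{u}.dist_horizontal
  taxi_le_dist := U0.{u}.taxi_le_dist

/-- The inclusion of the triadic grid into the unit square. -/
noncomputable def gridInclusion : grid.{u} ⟶ U0.{u} where
  toFun := Subtype.val
  short _ _ := le_rfl
  map_S _ := rfl

theorem isometry_gridInclusion : Isometry gridInclusion.{u}.toFun := isometry_subtype_coe

theorem denseRange_gridInclusion : DenseRange gridInclusion.{u}.toFun := by
  refine Metric.dense_iff.2 fun u ε hε => ?_
  obtain ⟨t, ht, hd⟩ := exists_triadic_dist_lt u.fst hε
  -- One triadic coordinate suffices, so only the first is moved.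
  refine ⟨⟨t, u.snd⟩, ?_, ⟨⟨⟨t, u.snd⟩, Or.inl ht⟩, rfl⟩⟩
  exact (dist_comm _ _).trans_lt ((dist_horizontal_eq.{u} u.snd u.fst t).trans_lt hd)

/-- The morphism `N ⊗ grid ⟶ grid` that takes a point of a cell to its position in the square. -/
noncomputable def gridStr : nTensor.obj grid.{u} ⟶ grid.{u} :=
  tensorDesc (fun a => ⟨cellPoint a.1 a.2.1, a.2.2.cellPoint a.1⟩)
    (fun _ _ _ _ h => Subtype.ext (cellPoint_S_eq_iff.2 (pos_eq_of_glue h)))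
    (fun n x y => (dist_cellPoint n x.1 y.1).le) fun p => Subtype.ext (cellPoint_third_zoom p)

/-- The triadic grid as an algebra. -/
noncomputable def gridAlgebra : Endofunctor.Algebra nTensor.{u} where
  a := grid
  str := gridStr

/-! ### The triadic grid is an initial algebra -/

section

variable {Y : SquaMS.{u}} (ν : nTensor.obj Y ⟶ Y)

/-- The graph of the algebra morphism from the triadic grid to `Y`. -/
inductive Graph : UnitSquare.{u} → Y.carrier → Prop
  | boundary (p : M0) : Graph (U0.{u}.S p) (Y.S p)
  | cell (n : N) {u : UnitSquare.{u}} {y : Y.carrier} (h : Graph u y) :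
    Graph (cellPoint n u) (ν.toFun (tmk n y))

theorem str_tmk_third_zoom (p : M0) :
    ν.toFun (tmk (third p.1.1, third p.1.2) (Y.S (zoom p))) = Y.S p :=
  ν.map_S p

theorem dist_str_tmk_le (n : N) (x y : Y.carrier) :
    dist (ν.toFun (tmk n x)) (ν.toFun (tmk n y)) ≤ dist x y / 3 :=
  (ν.short _ _).trans (dist_tmk_same_le n x y)

variable {ν}

/-- The rule for cells cannot contradict the rule for the boundary, because `ν` preserves boundary
maps. The induction varies `p`, since the hypothesis is needed at a boundary point of the smaller
cell. -/
theorem Graph.eq_S {u : UnitSquare.{u}} {y : Y.carrier} (h : Graph ν u y) {p : M0}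
    (hu : u = U0.{u}.S p) : y = Y.S p := by
  induction h generalizing p with
  | boundary q => rw [U0.{u}.S_injective hu]
  | @cell n u y h ih =>
    -- Now both sides are values of `ν` on cells, and the two cells can be compared.
    rw [← str_tmk_third_zoom ν p]
    rcases cellPoint_eq_cases (hu.trans (cellPoint_third_zoom p).symm) with
      ⟨rfl, hu'⟩ | ⟨q, q', hq, hq', hpos⟩
    · rw [ih hu']
    · obtain rfl := U0.{u}.S_injective hq'
      rw [ih hq.symm, tmk_eq_of_pos_eq hpos]

/-- Derivations through different cells can end at the same point only on the boundaries of these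
cells. There `Graph.eq_S` fixes the local values, and `N ⊗ Y` glues them. -/
theorem Graph.unique {u : UnitSquare.{u}} {y y' : Y.carrier} (h : Graph ν u y)
    (h' : Graph ν u y') : y = y' := by
  induction h generalizing y' with
  | boundary p => exact (h'.eq_S rfl).symm
  | @cell n u y h ih =>
    generalize hv : cellPoint n u = v at h'
    cases h' with
    | boundary p => exact (h.cell n).eq_S hv
    | @cell m u' y' h' =>
      rcases cellPoint_eq_cases hv with ⟨rfl, rfl⟩ | ⟨p, q, hp, hq, hpos⟩
      · rw [ih h']
      · rw [h.eq_S hp.symm, h'.eq_S hq.symm, tmk_eq_of_pos_eq hpos]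

variable (ν)

/-- Over a line with a triadic rational first coordinate (in the coordinates given by `place`) there
is a short section of the graph. -/
theorem exists_line (place : unitInterval → unitInterval → UnitSquare.{u})
    (cell : Fin 3 → Fin 3 → N)
    (hplace : ∀ i j r s, cellPoint (cell i j) (place r s) = place (shrink i r) (shrink j s))
    (hbdry : ∀ r, r = 0 ∨ r = 1 → ∃ e : unitInterval → M0, (∀ s, U0.S (e s) = place r s) ∧
      ∀ s t, dist (Y.S (e s)) (Y.S (e t)) ≤ dist s t)
    {r : unitInterval} (hr : Triadic r) :
    ∃ v : unitInterval → Y.carrier, (∀ s, Graph ν (place r s) (v s)) ∧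
      ∀ s t, dist (v s) (v t) ≤ dist s t := by
  have base : ∀ r, r = 0 ∨ r = 1 → ∃ v : unitInterval → Y.carrier,
      (∀ s, Graph ν (place r s) (v s)) ∧ ∀ s t, dist (v s) (v t) ≤ dist s t := by
    intro r hr
    obtain ⟨e, he, hd⟩ := hbdry r hr
    exact ⟨fun s => Y.S (e s), fun s => he s ▸ Graph.boundary (e s), hd⟩
  induction hr with
  | zero => exact base 0 (Or.inl rfl)
  | one => exact base 1 (Or.inr rfl)
  | @shrink i r hr ih =>
    obtain ⟨v, hv, hd⟩ := ih
    have hcell : ∀ j s, Graph ν (place (shrink i r) (shrink j s))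
        (ν.toFun (tmk (cell i j) (v s))) := fun j s => hplace i j r s ▸ (hv s).cell (cell i j)
    have hgraph : ∀ s, Graph ν (place (shrink i r) s)
        (ν.toFun (tmk (cell i (third s)) (v (expand s)))) := fun s => by
      have := hcell (third s) (expand s)
      rwa [shrink_third_expand] at this
    refine ⟨_, hgraph, unitInterval_dist_le_of_thirds _
      (fun j s => ν.toFun (tmk (cell i j) (v s))) (fun j s => ?_) (fun j s t => ?_)⟩
    -- At a common endpoint of two thirds both cells offer a value; single-valuedness makes them
    -- agree, so the pieces fit together.
    · exact (hgraph _).unique (hcell j s)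
    · exact (dist_str_tmk_le ν _ _ _).trans (div_le_div_of_nonneg_right (hd s t) (by norm_num))

theorem exists_vertical_line {r : unitInterval} (hr : Triadic r) :
    ∃ v : unitInterval → Y.carrier, (∀ s, Graph ν ⟨r, s⟩ (v s)) ∧
      ∀ s t, dist (v s) (v t) ≤ dist s t := by
  refine exists_line ν (fun r s => ⟨r, s⟩) (fun i j => (i, j)) (fun _ _ _ _ => rfl)
    (fun r hr => ?_) hr
  have hr' : (r : ℝ) = 0 ∨ (r : ℝ) = 1 := hr.imp (congrArg Subtype.val) (congrArg Subtype.val)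
  let e : unitInterval → M0 := fun s => ⟨(r, s), Or.inl ⟨hr', s.2⟩⟩
  refine ⟨e, fun s => rfl, fun s t => ?_⟩
  exact ((Y.dist_vertical (e s) (e t) rfl hr').trans (abs_sub_comm _ _)).le

/-- The same induction with the coordinates exchanged: `place` and `cell` are transposed. -/
theorem exists_horizontal_line {s : unitInterval} (hs : Triadic s) :
    ∃ v : unitInterval → Y.carrier, (∀ r, Graph ν ⟨r, s⟩ (v r)) ∧
      ∀ r t, dist (v r) (v t) ≤ dist r t := by
  refine exists_line ν (fun s r => ⟨r, s⟩) (fun j i => (i, j)) (fun _ _ _ _ => rfl)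
    (fun s hs => ?_) hs
  have hs' : (s : ℝ) = 0 ∨ (s : ℝ) = 1 := hs.imp (congrArg Subtype.val) (congrArg Subtype.val)
  let e : unitInterval → M0 := fun r => ⟨(r, s), Or.inr ⟨r.2, hs'⟩⟩
  refine ⟨e, fun r => rfl, fun r t => ?_⟩
  exact ((Y.dist_horizontal (e r) (e t) rfl hs').trans (abs_sub_comm _ _)).le

/-- The other coordinate is an arbitrary real, so the value is read off from a section over the
whole triadic line. -/
theorem exists_graph {u : UnitSquare.{u}} (hu : OnGrid u) : ∃ y, Graph ν u y := by
  rcases hu with h | h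
  · obtain ⟨v, hv, -⟩ := exists_vertical_line ν h
    exact ⟨_, hv u.snd⟩
  · obtain ⟨v, hv, -⟩ := exists_horizontal_line ν h
    exact ⟨_, hv u.fst⟩

variable {ν}

/-- By uniqueness, all values over the line are those of its short section. -/
theorem Graph.dist_le_vertical {r s s' : unitInterval} (hr : Triadic r) {y y' : Y.carrier}
    (h : Graph ν ⟨r, s⟩ y) (h' : Graph ν ⟨r, s'⟩ y') : dist y y' ≤ dist s s' := by
  obtain ⟨v, hv, hd⟩ := exists_vertical_line ν hr
  rw [h.unique (hv s), h'.unique (hv s')]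
  exact hd s s'

theorem Graph.dist_le_horizontal {s r r' : unitInterval} (hs : Triadic s) {y y' : Y.carrier}
    (h : Graph ν ⟨r, s⟩ y) (h' : Graph ν ⟨r', s⟩ y') : dist y y' ≤ dist r r' := by
  obtain ⟨v, hv, hd⟩ := exists_horizontal_line ν hs
  rw [h.unique (hv r), h'.unique (hv r')]
  exact hd r r'

/-- If the triadic lines through `u` and `v` are perpendicular, they cross at a corner of the
rectangle spanned by the points and give a path of exactly the taxicab length. If they are parallel,
the path changes lines along a perpendicular triadic line close to `u`, at arbitrarily small extra
cost. -/
theorem Graph.dist_le {u v : UnitSquare.{u}} (hu : OnGrid u) (hv : OnGrid v) {y z : Y.carrier}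
    (h : Graph ν u y) (h' : Graph ν v z) : dist y z ≤ dist u v := by
  obtain ⟨r, s⟩ := u
  obtain ⟨r', s'⟩ := v
  change dist y z ≤ dist r r' + dist s s'
  rcases hu with hr | hs
  · rcases hv with hr' | hs'
    · refine le_of_forall_pos_le_add fun ε hε => ?_
      -- The deviation from `s` to `t` enters twice, once on each vertical leg, hence half of `ε`.
      obtain ⟨t, ht, hd⟩ := exists_triadic_dist_lt s (half_pos hε)
      obtain ⟨x, hx⟩ := exists_graph ν (u := ⟨r, t⟩) (Or.inr ht)
      obtain ⟨x', hx'⟩ := exists_graph ν (u := ⟨r', t⟩) (Or.inr ht)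
      have h1 := h.dist_le_vertical hr hx
      have h2 := hx.dist_le_horizontal ht hx'
      have h3 := hx'.dist_le_vertical hr' h'
      have h4 := dist_triangle4 y x x' z
      have h5 := dist_triangle_left t s' s
      linarith
    · obtain ⟨x, hx⟩ := exists_graph ν (u := ⟨r, s'⟩) (Or.inl hr)
      have h1 := h.dist_le_vertical hr hx
      have h2 := hx.dist_le_horizontal hs' h'
      linarith [dist_triangle y x z]
  · rcases hv with hr' | hs'
    · obtain ⟨x, hx⟩ := exists_graph ν (u := ⟨r', s⟩) (Or.inl hr')
      have h1 := h.dist_le_horizontal hs hx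
      have h2 := hx.dist_le_vertical hr' h'
      linarith [dist_triangle y x z]
    · refine le_of_forall_pos_le_add fun ε hε => ?_
      obtain ⟨t, ht, hd⟩ := exists_triadic_dist_lt r (half_pos hε)
      obtain ⟨x, hx⟩ := exists_graph ν (u := ⟨t, s⟩) (Or.inl ht)
      obtain ⟨x', hx'⟩ := exists_graph ν (u := ⟨t, s'⟩) (Or.inl ht)
      have h1 := h.dist_le_horizontal hs hx
      have h2 := hx.dist_le_vertical ht hx'
      have h3 := hx'.dist_le_horizontal hs' h'
      have h4 := dist_triangle4 y x x' z
      have h5 := dist_triangle_left t r' r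
      linarith

variable (ν)

/-- The algebra morphism from the triadic grid to `Y`. -/
noncomputable def gridDesc : grid.{u} ⟶ Y where
  toFun u := (exists_graph ν u.2).choose
  short u v := (exists_graph ν u.2).choose_spec.dist_le u.2 v.2 (exists_graph ν v.2).choose_spec
  map_S p := (exists_graph ν (grid.{u}.S p).2).choose_spec.eq_S rfl

theorem graph_gridDesc (u : grid.{u}.carrier) : Graph ν u.1 ((gridDesc ν).toFun u) :=
  (exists_graph ν u.2).choose_spec

/-- Both sides give values of `Graph ν` over the same point. -/
theorem gridStr_comp_gridDesc : gridStr ≫ gridDesc ν = nTensor.map (gridDesc ν) ≫ ν :=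
  tensor_hom_ext fun n u =>
    (graph_gridDesc ν (gridStr.toFun (tmk n u))).unique ((graph_gridDesc ν u).cell n)

/-- The two rules of `Graph` are exactly what preservation of the boundary and of the algebra
structure force; this is the uniqueness half of initiality. -/
theorem Graph.eq_toFun {f : grid.{u} ⟶ Y} (hf : gridStr ≫ f = nTensor.map f ≫ ν)
    {u : UnitSquare.{u}} {y : Y.carrier} (h : Graph ν u y) : ∃ hu, f.toFun ⟨u, hu⟩ = y := by
  induction h with
  | boundary p => exact ⟨onGrid_S p, f.map_S p⟩
  | @cell n u y h ih =>
    obtain ⟨hu, rfl⟩ := ih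
    exact ⟨hu.cellPoint n,
      congrArg (fun g : nTensor.obj grid.{u} ⟶ Y => g.toFun (tmk n ⟨u, hu⟩)) hf⟩

theorem eq_gridDesc {f : grid.{u} ⟶ Y} (hf : gridStr ≫ f = nTensor.map f ≫ ν) :
    f = gridDesc ν :=
  SquaMS.Hom.ext (funext fun u => ((graph_gridDesc ν u).eq_toFun ν hf).2)

end

/-- The triadic grid is an initial algebra. -/
noncomputable def gridAlgebraIsInitial : IsInitial gridAlgebra.{u} :=
  IsInitial.ofUniqueHom (fun A => ⟨gridDesc A.str, (gridStr_comp_gridDesc A.str).symm⟩)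
    fun A m => Endofunctor.Algebra.Hom.ext (eq_gridDesc A.str m.h.symm)

/-! ### The completion of an initial algebra -/

section

open UniformSpace

variable {X : SquaMS.{u}} (j : X ⟶ U0.{u})

/-- The extension to the completion of a morphism to the unit square. -/
noncomputable def completionDesc : completionFunctor.obj X ⟶ U0.{u} where
  toFun := Completion.extension j.toFun
  short x y := ((SquaMS.Hom.lipschitz j).completion_extension.dist_le_mul x y).trans
    (one_mul (dist x y)).le
  map_S p := (Completion.extension_coe (SquaMS.Hom.lipschitz j).uniformContinuous _).trans
    (j.map_S p)

theorem completionDesc_coe (x : X.carrier) :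
    (completionDesc j).toFun (x : Completion X.carrier) = j.toFun x :=
  Completion.extension_coe (SquaMS.Hom.lipschitz j).uniformContinuous x

/-- The extension is again isometric, so its range is complete, hence closed, and it contains a
dense set. -/
theorem isIso_completionDesc (hj : Isometry j.toFun) (hd : DenseRange j.toFun) :
    IsIso (completionDesc j) := by
  have hi : Isometry (completionDesc j).toFun := hj.completion_extension
  refine isIso_of_isometry _ hi (Set.range_eq_univ.1 (Set.univ_subset_iff.1 ?_))
  have hclosed : IsClosed (Set.range (completionDesc j).toFun) :=
    have : CompleteSpace (completionFunctor.obj X).carrier :=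
      inferInstanceAs (CompleteSpace (Completion X.carrier))
    hi.isUniformInducing.isComplete_range.isClosed
  rw [← hd.closure_range]
  refine closure_minimal ?_ hclosed
  rintro _ ⟨x, rfl⟩
  exact ⟨_, completionDesc_coe j x⟩

theorem theta_coe (A : Endofunctor.Algebra nTensor.{u}) (n : N) (x : A.a.carrier) :
    (theta A).toFun (tmk (X := completion A.a) n (x : Completion A.a.carrier)) =
      (A.str.toFun (tmk n x) : Completion A.a.carrier) := by
  change Completion.map A.str.toFun (comparisonFun A.a (n, (x : Completion A.a.carrier))) = _
  rw [comparisonFun_coe]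
  exact Completion.map_coe (SquaMS.Hom.lipschitz A.str).uniformContinuous _

/-- In each cell both sides are continuous, and on the dense subset `A.a` they reduce to `hj`. Once
`completionDesc j` is invertible, this conjugates `theta A` to `squareStr`. -/
theorem theta_comp_completionDesc (A : Endofunctor.Algebra nTensor.{u}) (j : A.a ⟶ U0.{u})
    (hj : A.str ≫ j = nTensor.map j ≫ squareStr) :
    theta A ≫ completionDesc j = nTensor.map (completionDesc j) ≫ squareStr := by
  have hcont : ∀ (n : N) (f : nTensor.obj (completionFunctor.obj A.a) ⟶ U0.{u}),
      Continuous fun x : Completion A.a.carrier =>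
        f.toFun (tmk (X := completion A.a) n x) := fun n f =>
    (SquaMS.Hom.lipschitz f).continuous.comp (tmk_lipschitz (X := completion A.a) n).continuous
  refine tensor_hom_ext (X := completion A.a) fun n x => ?_
  refine Completion.induction_on (α := A.a.carrier) x
    (isClosed_eq (hcont n _) (hcont n _)) fun x => ?_
  change (completionDesc j).toFun ((theta A).toFun _) =
    squareStr.toFun (tmk (X := U0) n ((completionDesc j).toFun (x : Completion A.a.carrier)))
  rw [theta_coe, completionDesc_coe, completionDesc_coe]
  exact congrArg (fun g : nTensor.obj A.a ⟶ U0.{u} => g.toFun (tmk n x)) hj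

end

/-! ### Transfer to an arbitrary initial algebra -/

theorem isometry_of_isIso {X Y : SquaMS.{u}} (f : X ⟶ Y) [IsIso f] : Isometry f.toFun := by
  refine Isometry.of_dist_eq fun x y => le_antisymm (f.short x y) ?_
  have h : ∀ x, (inv f).toFun (f.toFun x) = x := fun x =>
    congrArg (fun g : X ⟶ X => g.toFun x) (IsIso.hom_inv_id f)
  simpa only [h] using (inv f).short (f.toFun x) (f.toFun y)

theorem surjective_of_isIso {X Y : SquaMS.{u}} (f : X ⟶ Y) [IsIso f] :
    Function.Surjective f.toFun := fun y =>
  ⟨(inv f).toFun y, congrArg (fun g : Y ⟶ Y => g.toFun y) (IsIso.inv_hom_id f)⟩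

/-- An initial algebra embeds isometrically and densely into the unit square. -/
theorem exists_dense_embedding {A : Endofunctor.Algebra nTensor.{u}} (hA : IsInitial A) :
    ∃ j : A.a ⟶ U0.{u}, Isometry j.toFun ∧ DenseRange j.toFun ∧
      A.str ≫ j = nTensor.map j ≫ squareStr := by
  let e : A ≅ gridAlgebra.{u} := hA.uniqueUpToIso gridAlgebraIsInitial
  let f : A.a ⟶ grid.{u} := e.hom.f
  have : IsIso f := ((Endofunctor.Algebra.forget nTensor).mapIso e).isIso_hom
  refine ⟨f ≫ gridInclusion, isometry_gridInclusion.comp (isometry_of_isIso f),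
    denseRange_gridInclusion.comp (surjective_of_isIso f).denseRange
      isometry_gridInclusion.continuous, ?_⟩
  have h : nTensor.map f ≫ gridStr = A.str ≫ f := e.hom.h
  -- The algebra structure of the grid is the restriction of that of the square.
  have h' : gridStr ≫ gridInclusion = nTensor.map gridInclusion ≫ squareStr.{u} :=
    tensor_hom_ext fun _ _ => rfl
  rw [← Category.assoc, ← h, Category.assoc, h', nTensor.map_comp, Category.assoc]

end SquareMetric

/-- The functor `N ⊗ -` on square metric spaces has an initial algebra. For every initial algebra
`(W, λ)`, with Cauchy completion `V = C W`, the induced morphism `θ : N ⊗ V ⟶ V` is an isomorphism,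
`(V, θ⁻¹)` is a final coalgebra for `N ⊗ -`, and `V` is isomorphic to the unit square `U₀` with the
taxicab metric. -/
theorem mainTheorem5 :
    HasInitial (Endofunctor.Algebra SquareMetric.nTensor.{u}) ∧
    ∀ A : Endofunctor.Algebra SquareMetric.nTensor.{u}, Nonempty (IsInitial A) →
      ∃ _ : IsIso (SquareMetric.theta A),
        Nonempty (IsTerminal
          ({ V := SquareMetric.completionFunctor.obj A.a
             str := inv (SquareMetric.theta A) } :
            Endofunctor.Coalgebra SquareMetric.nTensor.{u})) ∧
        Nonempty (SquareMetric.completionFunctor.obj A.a ≅ SquareMetric.U0.{u}) := by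
  refine ⟨SquareMetric.gridAlgebraIsInitial.hasInitial, ?_⟩
  rintro A ⟨hA⟩
  obtain ⟨j, hj, hd, hstr⟩ := SquareMetric.exists_dense_embedding hA
  have hiso := SquareMetric.isIso_completionDesc j hj hd
  have hcomm := SquareMetric.theta_comp_completionDesc A j hstr
  -- By `hcomm` this composite is also a composite of isomorphisms; cancelling the invertible
  -- `completionDesc j` leaves `theta A`.
  have hcomp : IsIso (SquareMetric.theta A ≫ SquareMetric.completionDesc j) := by
    rw [hcomm]
    infer_instance
  have htheta : IsIso (SquareMetric.theta A) := IsIso.of_isIso_comp_right _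
    (SquareMetric.completionDesc j)
  let e := asIso (SquareMetric.completionDesc j)
  refine ⟨htheta, ⟨SquareMetric.squareCoalgebraIsTerminal.ofIso
    (Endofunctor.Coalgebra.isoMk e ?_).symm⟩, ⟨e⟩⟩
  -- The coalgebra square is the algebra square `hcomm` with both structure maps inverted.
  change inv _ ≫ SquareMetric.nTensor.map (SquareMetric.completionDesc j) =
    SquareMetric.completionDesc j ≫ inv SquareMetric.squareStr
  rw [IsIso.inv_comp_eq, ← Category.assoc, IsIso.eq_comp_inv, hcomm]
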